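/- Let $q$ be a power of $2$, let $n\ge 0$, and let $Sp(2n,q)$ be the group of invertible linear maps of $V=\mathbb F_q^{2n}$ preserving the standard nondegenerate alternating form $\omega$ (with $|Sp(0,q)|=1$). Call $g\in Sp(2n,q)$ an involution if $g^2=1$ (so the identity is included). Put $$ \begin{aligned} A_r&=q^{r(r+1)/2+r(2n-2r)}\,|Sp(r,q)|\,|Sp(2n-2r,q)| && (r\text{ even},\ 0\le r\le n),\\ B_r&=q^{r(r+1)/2+r(2n-2r)}\,q^{r-1}\,|Sp(r-2,q)|\,|Sp(2n-2r,q)| && (r\text{ even},\ 1\le r\le n),\\ C_r&=q^{r(r+1)/2+r(2n-2r)}\,|Sp(r-1,q)|\,|Sp(2n-2r,q)| && (r\text{ odd},\ 1\le r\le n). \end{aligned} $$ Then the number of involutions in $Sp(2n,q)$ is $$ \sum_{\substack{0\le r\le n\\ r\text{ even}}}\frac{|Sp(2n,q)|}{A_r}+\sum_{\substack{1\le r\le n\\ r\text{ even}}}\frac{|Sp(2n,q)|}{B_r}+\sum_{\substack{1\le r\le n\\ r\text{ odd}}}\frac{|Sp(2n,q)|}{C_r}. $$ Moreover, for every involution $g$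 the rank $r$ of $g-1$ is at most $n$, and the bilinear form $\beta_g(x,y)=\omega(x,(g-1)y)$ on $V$ is symmetric, and it is not alternating if $r$ is odd. The three kinds of terms correspond to the involutions $g$ with $g-1$ of rank $r$ as follows. 1. For $r$ even, $0\le r\le n$, there are exactly $|Sp(2n,q)|/A_r$ of them with $\beta_g$ alternating, and each of these has a centralizer in $Sp(2n,q)$ of order $A_r$. 2. For $r$ even, $1\le r\le n$, there are exactly $|Sp(2n,q)|/B_r$ of them with $\beta_g$ not alternating, and each of these has a centralizer of order $B_r$. 3. For $r$ odd, $1\le r\le n$, there are exactly $|Sp(2n,q)|/C_r$ of them, and each of these has a centralizer of order $C_r$. -/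

import Mathlib

/-- The symplectic group `Sp(2k, F)`: the `2k × 2k` matrices over `F` preserving the standard
nondegenerate alternating form with Gram matrix `Matrix.J (Fin k) F`. -/
abbrev Sp (k : ℕ) (F : Type*) [Field F] := Matrix.symplecticGroup (Fin k) F

/-- The order `|Sp(m, F)|` for an even dimension `m` (it is only used for even `m`). -/
noncomputable def spOrder (F : Type*) [Field F] (m : ℕ) : ℕ := Nat.card (Sp (m / 2) F)

/-- The numbers `A_r`, for `r` even with `0 ≤ r ≤ n`; here `q = |F|`. -/
noncomputable def spA (F : Type*) [Field F] (n r : ℕ) : ℕ :=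
  Nat.card F ^ (r * (r + 1) / 2 + r * (2 * n - 2 * r)) * spOrder F r * spOrder F (2 * n - 2 * r)

/-- The numbers `B_r`, for `r` even with `1 ≤ r ≤ n`; here `q = |F|`. -/
noncomputable def spB (F : Type*) [Field F] (n r : ℕ) : ℕ :=
  Nat.card F ^ (r * (r + 1) / 2 + r * (2 * n - 2 * r)) * Nat.card F ^ (r - 1) *
    spOrder F (r - 2) * spOrder F (2 * n - 2 * r)

/-- The numbers `C_r`, for `r` odd with `1 ≤ r ≤ n`; here `q = |F|`. -/
noncomputable def spC (F : Type*) [Field F] (n r : ℕ) : ℕ :=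
  Nat.card F ^ (r * (r + 1) / 2 + r * (2 * n - 2 * r)) *
    spOrder F (r - 1) * spOrder F (2 * n - 2 * r)

/-- The elements `g` of `Sp(2n, F)` with `g ^ 2 = 1`; the identity is counted. -/
def spInvolutions (n : ℕ) (F : Type*) [Field F] : Set (Sp n F) := {g | g ^ 2 = 1}

/-- The rank of `g - 1`. -/
noncomputable def fixRank {n : ℕ} {F : Type*} [Field F] (g : Sp n F) : ℕ :=
  (g.1 - 1).rank

/-- The bilinear form `(x, y) ↦ ω(x, (g - 1) y)` on `F ^ (2n)`, where `ω(x, y) = xᵀ J y` is the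
form preserved by `Sp(2n, F)`. -/
noncomputable def attachedForm {n : ℕ} {F : Type*} [Field F] (g : Sp n F) :
    LinearMap.BilinForm F (Fin n ⊕ Fin n → F) :=
  Matrix.toBilin' (Matrix.J (Fin n) F * (g.1 - 1))

open Matrix

set_option linter.unusedSectionVars false

/-! ### Splitting off hyperbolic pairs -/

section SymplecticFamilies

variable {F V : Type*} [Field F] [AddCommGroup V] [Module F V]

/-! For an involution `g` put `N = g - 1`. In characteristic 2, `N² = 0`, and `gᵀ J = J g` makes
`β(x, y) = ω(x, N y)` symmetric. On a complement `C` of `ker N` the form `β` is nondegenerate, of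
dimension `r = rank N`. Over a finite field of characteristic 2 such a form has one of three Gram
matrices `S`: `J`, `diag(1, J)`, or `[[0, 1], [1, 1]]` plus `J` (`exists_gramMatrix_eq_J`,
`exists_gramMatrix_eq_oddForm_or_evenForm`).

A basis of `C` with Gram matrix `S` extends to a basis of `V` in which the pair `(ω, β)` is
`(hypForm κ J, degForm S)` (`exists_adapted_family`). As `J` is invertible, `g` is recovered from
`β`, so `S` and `m = n - r` determine the conjugacy class of `g`; every such pair occurs
(`exists_involution_hasNormalForm`).

The centralizer of `g` is the isometry group of `(ω, β)`. In the normal form it consists of block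
triangular matrices with free parameters: an isometry of `S`, an element of `Sp(2m)`, an arbitrary
`2m × r` matrix and a symmetric `r × r` matrix (`card_pairIsom_hypForm_degForm`). The isometry
groups of the three `S` have orders `|Sp(r)|`, `|Sp(r-1)|` and `q^(r-1) |Sp(r-2)|`, which gives
`A_r`, `C_r`, `B_r`. Orbit-stabilizer then gives the class sizes, and rank together with alternation
of `β` separates the classes. -/

/-- The Gram matrix of two families of vectors. -/
def gramMatrix {ι κ : Type*} (B : LinearMap.BilinForm F V) (v : ι → V) (w : κ → V) : Matrix ι κ F :=
  Matrix.of fun i j => B (v i) (w j)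

@[simp] theorem gramMatrix_apply {ι κ : Type*} (B : LinearMap.BilinForm F V) (v : ι → V) (w : κ → V)
    (i : ι) (j : κ) : gramMatrix B v w i j = B (v i) (w j) := rfl

theorem linearIndependent_of_isUnit_gramMatrix {κ : Type*} [Fintype κ] [DecidableEq κ]
    (B : LinearMap.BilinForm F V) (v : κ → V) (hG : IsUnit (gramMatrix B v v)) :
    LinearIndependent F v := by
  rw [Fintype.linearIndependent_iff]
  intro c hc
  have h : gramMatrix B v v *ᵥ c = 0 := by
    ext i
    have : B (v i) (∑ j, c j • v j) = 0 := by simp [hc]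
    simpa [Matrix.mulVec, dotProduct, mul_comm] using this
  have := (Matrix.mulVec_injective_iff_isUnit.2 hG) (h.trans (Matrix.mulVec_zero _).symm)
  exact fun i => congrFun this i

/-- Hyperbolic pairs orthogonal to `v` are split off one at a time and appended to `v`, whose Gram
matrix stays invertible. Alternation is required only on the orthogonal complement of `v`, so the
lemma also serves non-alternating `B` once `v` absorbs the diagonal. -/
theorem exists_symplectic_family [FiniteDimensional F V] [CharP F 2]
    (B : LinearMap.BilinForm F V) (hB : ∀ x, (∀ y, B x y = 0) → x = 0)
    (hs : ∀ x y, B x y = B y x) {κ : Type} [Fintype κ] [DecidableEq κ]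
    (v : κ → V) (hG : IsUnit (gramMatrix B v v)) (halt : ∀ x, (∀ i, B (v i) x = 0) → B x x = 0) :
    ∃ (k : ℕ) (u : Fin k ⊕ Fin k → V), gramMatrix B v u = 0 ∧
      gramMatrix B u u = Matrix.J (Fin k) F ∧
      Fintype.card κ + 2 * k = Module.finrank F V := by
  -- Induction on a bound `d` for the codimension of the span of `v`, with the index type `κ`
  -- varying.
  obtain ⟨d, hd⟩ : ∃ d, Module.finrank F V ≤ Fintype.card κ + d :=
    ⟨Module.finrank F V, Nat.le_add_left _ _⟩
  induction d generalizing κ with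
  | zero =>
    have := (linearIndependent_of_isUnit_gramMatrix B v hG).fintype_card_le_finrank
    refine ⟨0, fun i => 0, ?_, ?_, by omega⟩
    · ext i j; simp
    · ext i j; rcases i with i | i <;> exact i.elim0
  | succ d ih =>
    by_cases hx : ∃ x, x ≠ 0 ∧ ∀ i, B (v i) x = 0
    · obtain ⟨x, hx0, hx⟩ := hx
      obtain ⟨y₀, hy₀⟩ : ∃ y, B x y ≠ 0 := by
        by_contra! h
        exact hx0 (hB x h)
      -- `c` gives the orthogonal projection of `y₀` to the span of `v`. Subtracting it does not
      -- change the pairing with `x`, which is orthogonal to `v`.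
      obtain ⟨c, hc⟩ := (Matrix.mulVec_surjective_iff_isUnit.2 hG) fun i => B (v i) y₀
      set y := (B x y₀)⁻¹ • (y₀ - ∑ j, c j • v j) with hy
      have hvy : ∀ i, B (v i) y = 0 := by
        intro i
        have := congrFun hc i
        simp only [Matrix.mulVec, dotProduct, gramMatrix_apply] at this
        simp [hy, ← this, mul_comm]
      have hxy : B x y = 1 := by
        have h0 : ∀ j, B x (v j) = 0 := fun j => (hs x (v j)).trans (hx j)
        have h1 : B x (∑ j, c j • v j) = 0 := by simp [h0]
        rw [hy, map_smul, map_sub, h1, sub_zero, smul_eq_mul, inv_mul_cancel₀ hy₀]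
      have hxx := halt x hx
      have hyy := halt y hvy
      have hvx' : ∀ i, B x (v i) = 0 := fun i => (hs _ _).trans (hx i)
      have hvy' : ∀ i, B y (v i) = 0 := fun i => (hs _ _).trans (hvy i)
      have hyx : B y x = 1 := (hs _ _).trans hxy
      let w : Unit ⊕ Unit → V := Sum.elim (fun _ => x) (fun _ => y)
      have hG' : gramMatrix B (Sum.elim v w) (Sum.elim v w) =
          Matrix.fromBlocks (gramMatrix B v v) 0 0 (Matrix.fromBlocks 0 1 1 0) := by
        ext i j
        rcases i with i | i | i <;> rcases j with j | j | j <;>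
          simp [w, hx, hvy, hxx, hyy, hxy, hvx', hvy', hyx]
      have hU : IsUnit (gramMatrix B (Sum.elim v w) (Sum.elim v w)) := by
        rw [hG', Matrix.isUnit_iff_isUnit_det, Matrix.det_fromBlocks_zero₂₁]
        refine ((Matrix.isUnit_iff_isUnit_det _).1 hG).mul ?_
        rw [← Matrix.isUnit_iff_isUnit_det]
        refine IsUnit.of_mul_eq_one (Matrix.fromBlocks 0 1 1 0) ?_
        simp [Matrix.fromBlocks_multiply]
      obtain ⟨k, u, hvu, huu, hk⟩ := ih (Sum.elim v w) hU
        (fun z hz => halt z fun i => hz (Sum.inl i)) (by simp; omega)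
      have hvu' : ∀ i j, B (Sum.elim v w i) (u j) = 0 := fun i j => congrFun₂ hvu i j
      have huu' : ∀ i j, B (u i) (u j) = Matrix.J (Fin k) F i j := fun i j => congrFun₂ huu i j
      have hxu : ∀ j, B x (u j) = 0 := fun j => hvu' (Sum.inr (Sum.inl ())) j
      have hyu : ∀ j, B y (u j) = 0 := fun j => hvu' (Sum.inr (Sum.inr ())) j
      have hux : ∀ j, B (u j) x = 0 := fun i => (hs _ _).trans (hxu i)
      have huy : ∀ j, B (u j) y = 0 := fun i => (hs _ _).trans (hyu i)
      have hvu' : ∀ i j, B (v i) (u j) = 0 := fun i j => hvu' (Sum.inl i) j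
      refine ⟨k + 1, Sum.elim (Fin.cons x fun i => u (Sum.inl i))
        (Fin.cons y fun i => u (Sum.inr i)), ?_, ?_, ?_⟩
      · ext i j
        rcases j with j | j <;> refine Fin.cases ?_ (fun j => ?_) j <;> simp [hx, hvy, hvu']
      · ext i j
        rcases i with i | i <;> rcases j with j | j <;> refine Fin.cases ?_ (fun i => ?_) i <;>
          refine Fin.cases ?_ (fun j => ?_) j <;>
          simp [hxx, hyy, hxu, hyu, hyx, hxy, huu', hux, huy, Matrix.J,
            Matrix.one_apply, CharTwo.neg_eq, (Fin.succ_ne_zero _).symm]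
      · simp at hk; omega
    -- Nothing nonzero is orthogonal to `v`, so pairing with `v` embeds `V` into `κ → F`; hence `v`
    -- is already a basis and `k = 0`.
    · push Not at hx
      have h1 := (linearIndependent_of_isUnit_gramMatrix B v hG).fintype_card_le_finrank
      let f : V →ₗ[F] (κ → F) := LinearMap.pi fun i => B (v i)
      have hf : Function.Injective f := by
        rw [← LinearMap.ker_eq_bot, LinearMap.ker_eq_bot']
        intro x h
        by_contra hx0
        obtain ⟨i, hi⟩ := hx x hx0
        exact hi (congrFun h i)
      have h2 := LinearMap.finrank_le_finrank_of_injective hf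
      simp at h2
      refine ⟨0, fun i => 0, ?_, ?_, by omega⟩
      · ext i j; simp
      · ext i j; rcases i with i | i <;> exact i.elim0

end SymplecticFamilies

/-! ### Isometry groups of pairs of forms -/

section Isometries

variable {F : Type*} [Field F] {ι κ μ : Type*} [Fintype ι] [Fintype κ] [Fintype μ]
  [DecidableEq ι] [DecidableEq κ] [DecidableEq μ]

/-- The matrices preserving the form with Gram matrix `M`. -/
def isom (M : Matrix ι ι F) : Set (Matrix ι ι F) := {X | Xᵀ * M * X = M}

/-- The matrices preserving both forms with Gram matrices `M₁` and `M₂`. -/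
def pairIsom (M₁ M₂ : Matrix ι ι F) : Set (Matrix ι ι F) := isom M₁ ∩ isom M₂

theorem conj_mem_isom {M : Matrix ι ι F} {P : Matrix ι κ F} {Q : Matrix κ ι F}
    (hPQ : P * Q = 1) {X : Matrix κ κ F} (hX : X ∈ isom (Pᵀ * M * P)) : P * X * Q ∈ isom M := by
  have hX : Xᵀ * (Pᵀ * M * P) * X = Pᵀ * M * P := hX
  have hQ : Qᵀ * Pᵀ = 1 := by rw [← transpose_mul, hPQ, transpose_one]
  calc (P * X * Q)ᵀ * M * (P * X * Q) = Qᵀ * (Xᵀ * (Pᵀ * M * P) * X) * Q := by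
        simp only [transpose_mul, Matrix.mul_assoc]
    _ = (Qᵀ * Pᵀ) * M * (P * Q) := by rw [hX]; simp only [Matrix.mul_assoc]
    _ = M := by rw [hQ, hPQ, Matrix.one_mul, Matrix.mul_one]

theorem card_pairIsom_congr (M₁ M₂ : Matrix ι ι F) {P : Matrix ι κ F} {Q : Matrix κ ι F}
    (hPQ : P * Q = 1) (hQP : Q * P = 1) :
    Nat.card (pairIsom (Pᵀ * M₁ * P) (Pᵀ * M₂ * P)) = Nat.card (pairIsom M₁ M₂) := by
  have hback : ∀ M : Matrix ι ι F, Qᵀ * (Pᵀ * M * P) * Q = M := by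
    intro M
    have hQ : Qᵀ * Pᵀ = 1 := by rw [← transpose_mul, hPQ, transpose_one]
    calc Qᵀ * (Pᵀ * M * P) * Q = (Qᵀ * Pᵀ) * M * (P * Q) := by simp only [Matrix.mul_assoc]
      _ = M := by rw [hQ, hPQ, Matrix.one_mul, Matrix.mul_one]
  refine Nat.card_congr
    { toFun := fun X => ⟨P * X.1 * Q, conj_mem_isom hPQ X.2.1, conj_mem_isom hPQ X.2.2⟩
      invFun := fun Y => ⟨Q * Y.1 * P, conj_mem_isom hQP ?_, conj_mem_isom hQP ?_⟩
      left_inv := fun X => Subtype.ext ?_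
      right_inv := fun Y => Subtype.ext ?_ }
  · rw [hback]; exact Y.2.1
  · rw [hback]; exact Y.2.2
  · calc Q * (P * X.1 * Q) * P = (Q * P) * X.1 * (Q * P) := by simp only [Matrix.mul_assoc]
      _ = X.1 := by rw [hQP, Matrix.one_mul, Matrix.mul_one]
  · calc P * (Q * Y.1 * P) * Q = (P * Q) * Y.1 * (P * Q) := by simp only [Matrix.mul_assoc]
      _ = Y.1 := by rw [hPQ, Matrix.one_mul, Matrix.mul_one]

theorem isUnit_of_mem_isom {M X : Matrix ι ι F} (hM : IsUnit M) (hX : X ∈ isom M) : IsUnit X := by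
  have hX : Xᵀ * M * X = M := hX
  have h := hM
  rw [← hX] at h
  exact isUnit_of_mul_isUnit_right h

/-- Symmetric matrices are functions on unordered pairs. -/
theorem card_isSymm_matrix [Finite F] (κ : Type*) [Fintype κ] :
    Nat.card {M : Matrix κ κ F // Mᵀ = M} =
      Nat.card F ^ (Fintype.card κ * (Fintype.card κ + 1) / 2) := by
  classical
  have e : {M : Matrix κ κ F // Mᵀ = M} ≃ (Sym2 κ → F) :=
    { toFun := fun M => Sym2.lift ⟨fun i j => M.1 i j, fun i j => congrFun₂ M.2.symm i j⟩
      invFun := fun f => ⟨Matrix.of fun i j => f s(i, j), by ext i j; simp [Sym2.eq_swap]⟩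
      left_inv := fun M => by ext i j; simp
      right_inv := fun f => by ext s; induction s with | _ i j => simp }
  rw [Nat.card_congr e, Nat.card_fun, Nat.card_eq_fintype_card (α := Sym2 κ), Sym2.card,
    Nat.choose_two_right, Nat.add_sub_cancel, mul_comm]

/-- Keep the strictly upper triangular part for some ordering of the indices. This replaces division
by 2. -/
theorem exists_add_transpose_eq {κ : Type*} [Finite κ] {A : Matrix κ κ F}
    (hs : Aᵀ = A) (hd : ∀ i, A i i = 0) : ∃ M : Matrix κ κ F, M + Mᵀ = A := by
  obtain ⟨n, ⟨e⟩⟩ := Finite.exists_equiv_fin κ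
  refine ⟨Matrix.of fun i j => if e i < e j then A i j else 0, ?_⟩
  ext i j
  have hij : A j i = A i j := congrFun₂ hs i j
  rcases lt_trichotomy (e i) (e j) with h | h | h
  · simp [h, h.not_gt]
  · obtain rfl := e.injective h
    simp [hd]
  · simp [h, h.not_gt, hij]

/-- Writing `A = M + Mᵀ`, the conjugate is `Y + Yᵀ` with `Y = Xᵀ M X`, whose diagonal is `2 Y k k =
0`. -/
theorem diag_conj_eq_zero [CharP F 2] {A : Matrix ι ι F} (hs : Aᵀ = A) (hd : ∀ i, A i i = 0)
    {κ : Type*} (X : Matrix ι κ F) (k : κ) : (Xᵀ * A * X) k k = 0 := by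
  obtain ⟨M, rfl⟩ := exists_add_transpose_eq hs hd
  have h : (Xᵀ * Mᵀ * X) = (Xᵀ * M * X)ᵀ := by
    simp only [transpose_mul, transpose_transpose, Matrix.mul_assoc]
  rw [Matrix.mul_add, Matrix.add_mul, h, Matrix.add_apply, transpose_apply, CharTwo.add_self_eq_zero]

/-- The form `diag(hyperbolic, A)` on `F ^ κ ⊕ F ^ κ ⊕ F ^ μ`. -/
def hypForm (κ : Type*) [DecidableEq κ] (A : Matrix μ μ F) :
    Matrix ((κ ⊕ κ) ⊕ μ) ((κ ⊕ κ) ⊕ μ) F :=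
  fromBlocks (fromBlocks 0 1 1 0) 0 0 A

/-- The degenerate form given by `S` on the second summand of `F ^ κ ⊕ F ^ κ ⊕ F ^ μ`. -/
def degForm (μ : Type*) (S : Matrix κ κ F) : Matrix ((κ ⊕ κ) ⊕ μ) ((κ ⊕ κ) ⊕ μ) F :=
  fromBlocks (fromBlocks 0 0 0 S) 0 0 0

/-- A `3 × 3` block matrix. -/
def blocks₃ (a c z e : Matrix κ κ F) (b z' : Matrix κ μ F) (z'' d : Matrix μ κ F)
    (h : Matrix μ μ F) : Matrix ((κ ⊕ κ) ⊕ μ) ((κ ⊕ κ) ⊕ μ) F :=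
  fromBlocks (fromBlocks a c z e) (fromRows b z') (fromCols z'' d) h

theorem exists_eq_blocks₃ (X : Matrix ((κ ⊕ κ) ⊕ μ) ((κ ⊕ κ) ⊕ μ) F) :
    ∃ a c z e b z' z'' d h, X = blocks₃ a c z e b z' z'' d h :=
  ⟨_, _, _, _, _, _, _, _, _, by
    rw [blocks₃, fromBlocks_toBlocks X.toBlocks₁₁, fromRows_toRows X.toBlocks₁₂,
      fromCols_toCols X.toBlocks₂₁, fromBlocks_toBlocks]⟩

theorem blocks₃_inj {a c z e a' c' z₁ e' : Matrix κ κ F} {b z' b' z₁' : Matrix κ μ F}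
    {z'' d z₁'' d' : Matrix μ κ F} {h h' : Matrix μ μ F} :
    blocks₃ a c z e b z' z'' d h = blocks₃ a' c' z₁ e' b' z₁' z₁'' d' h' ↔
      (a = a' ∧ c = c' ∧ z = z₁ ∧ e = e') ∧ (b = b' ∧ z' = z₁') ∧ (z'' = z₁'' ∧ d = d') ∧
        h = h' := by
  simp only [blocks₃, fromBlocks_inj, fromRows_ext_iff, fromCols_ext_iff]

theorem hypForm_eq (A : Matrix μ μ F) : hypForm κ A = blocks₃ 0 1 1 0 0 0 0 0 A := by
  simp [hypForm, blocks₃]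

theorem degForm_eq (S : Matrix κ κ F) : degForm μ S = blocks₃ 0 0 0 S 0 0 0 0 0 := by
  simp [degForm, blocks₃]

theorem blocks₃_conj_hypForm (a c z e : Matrix κ κ F) (b z' : Matrix κ μ F) (z'' d : Matrix μ κ F)
    (h A : Matrix μ μ F) :
    (blocks₃ a c z e b z' z'' d h)ᵀ * hypForm κ A * blocks₃ a c z e b z' z'' d h =
      blocks₃ (zᵀ * a + aᵀ * z + z''ᵀ * A * z'') (zᵀ * c + aᵀ * e + z''ᵀ * A * d)
        (eᵀ * a + cᵀ * z + dᵀ * A * z'') (eᵀ * c + cᵀ * e + dᵀ * A * d)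
        (zᵀ * b + aᵀ * z' + z''ᵀ * A * h) (eᵀ * b + cᵀ * z' + dᵀ * A * h)
        (z'ᵀ * a + bᵀ * z + hᵀ * A * z'') (z'ᵀ * c + bᵀ * e + hᵀ * A * d)
        (z'ᵀ * b + bᵀ * z' + hᵀ * A * h) := by
  simp [blocks₃, hypForm, fromBlocks_transpose, fromBlocks_multiply, transpose_fromRows,
    transpose_fromCols, fromRows_mul, mul_fromCols, fromCols_mul_fromRows, fromBlocks_mul_fromRows,
    fromCols_mul_fromBlocks, Matrix.mul_assoc]
  refine ⟨fromBlocks_add _ _ _ _ _ _ _ _, ?_, ?_⟩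
  · ext i j
    rcases i with i | i <;> simp
  · ext i j
    rcases j with j | j <;> simp

theorem blocks₃_conj_degForm (a c z e S : Matrix κ κ F) (b z' : Matrix κ μ F)
    (z'' d : Matrix μ κ F) (h : Matrix μ μ F) :
    (blocks₃ a c z e b z' z'' d h)ᵀ * degForm μ S * blocks₃ a c z e b z' z'' d h =
      blocks₃ (zᵀ * S * z) (zᵀ * S * e) (eᵀ * S * z) (eᵀ * S * e)
        (zᵀ * S * z') (eᵀ * S * z') (z'ᵀ * S * z) (z'ᵀ * S * e) (z'ᵀ * S * z') := by
  simp [blocks₃, degForm, fromBlocks_transpose, fromBlocks_multiply, transpose_fromRows,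
    transpose_fromCols, fromCols_mul_fromRows, fromBlocks_mul_fromRows,
    fromCols_mul_fromBlocks, Matrix.mul_assoc]

/-- The equation `eᵀ S e = S` makes `eᵀ S` invertible, which kills `z` and `z'`; then `hᵀ A h = A`
makes `A h` invertible, which kills `z''`. In what remains, `a` is determined by `e`, `b` by `d`,
`e`, `h`, and `c` satisfies one affine equation. -/
theorem blocks₃_mem_pairIsom_iff {A : Matrix μ μ F} {S : Matrix κ κ F} (hA : IsUnit A)
    (hAs : Aᵀ = A) (hS : IsUnit S)
    (a c z e : Matrix κ κ F) (b z' : Matrix κ μ F) (z'' d : Matrix μ κ F) (h : Matrix μ μ F) :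
    blocks₃ a c z e b z' z'' d h ∈ pairIsom (hypForm κ A) (degForm μ S) ↔
      (z = 0 ∧ z' = 0 ∧ z'' = 0) ∧ eᵀ * S * e = S ∧ hᵀ * A * h = A ∧ aᵀ * e = 1 ∧
        bᵀ * e + hᵀ * A * d = 0 ∧ eᵀ * c + cᵀ * e + dᵀ * A * d = 0 := by
  have hmem : blocks₃ a c z e b z' z'' d h ∈ pairIsom (hypForm κ A) (degForm μ S) ↔
      (blocks₃ a c z e b z' z'' d h)ᵀ * hypForm κ A * blocks₃ a c z e b z' z'' d h = hypForm κ A ∧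
      (blocks₃ a c z e b z' z'' d h)ᵀ * degForm μ S * blocks₃ a c z e b z' z'' d h =
        degForm μ S := Iff.rfl
  rw [hmem, blocks₃_conj_hypForm, blocks₃_conj_degForm, hypForm_eq, degForm_eq, blocks₃_inj,
    blocks₃_inj]
  constructor
  · rintro ⟨⟨⟨-, h1, -, h2⟩, ⟨h3, -⟩, ⟨-, h4⟩, h5⟩, ⟨⟨-, -, h6, h7⟩, ⟨-, h8⟩, -, -⟩⟩
    have heS : IsUnit (eᵀ * S) := isUnit_of_mul_isUnit_left (h7 ▸ hS)
    have hz : z = 0 := heS.mul_right_injective (by simpa using h6)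
    have hz' : z' = 0 := by
      have := congrArg (fun M => (eᵀ * S)⁻¹ * M) h8
      rwa [Matrix.mul_zero, Matrix.nonsing_inv_mul_cancel_left _ _
        ((Matrix.isUnit_iff_isUnit_det _).1 heS)] at this
    subst hz hz'
    simp only [transpose_zero, Matrix.zero_mul, Matrix.mul_zero, zero_add] at h1 h2 h3 h4 h5
    have hAh : IsUnit (A * h) := by
      rw [Matrix.mul_assoc] at h5
      exact isUnit_of_mul_isUnit_right (h5 ▸ hA)
    have hz'' : z'' = 0 := by
      have := congrArg (fun M => M * (A * h)⁻¹) h3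
      rw [Matrix.zero_mul, Matrix.mul_assoc z''ᵀ, Matrix.mul_nonsing_inv_cancel_right _ _
        ((Matrix.isUnit_iff_isUnit_det _).1 hAh)] at this
      exact transpose_eq_zero.1 this
    subst hz''
    simp at h1
    exact ⟨⟨rfl, rfl, rfl⟩, h7, h5, h1, h4, h2⟩
  · rintro ⟨⟨rfl, rfl, rfl⟩, h1, h2, h3, h4, h5⟩
    have h3' := congrArg transpose h3
    have h4' := congrArg transpose h4
    simp only [transpose_add, transpose_mul, transpose_transpose, transpose_one, transpose_zero,
      hAs] at h3' h4'
    rw [← Matrix.mul_assoc] at h4'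
    simp [h1, h2, h3, h4, h5, h3', h4']

theorem matrix_add_self_eq_zero [CharP F 2] {ι κ : Type*} (A : Matrix ι κ F) : A + A = 0 := by
  ext i j
  exact CharTwo.add_self_eq_zero _

theorem matrix_add_eq_zero_iff [CharP F 2] {ι κ : Type*} {A B : Matrix ι κ F} :
    A + B = 0 ↔ A = B := by
  constructor
  · intro h
    rw [← sub_eq_zero, ← h]
    ext i j
    simp [CharTwo.sub_eq_add]
  · rintro rfl
    exact matrix_add_self_eq_zero _

/-- The condition on `c` reads `eᵀ c + (eᵀ c)ᵀ = dᵀ A d`. The right side is alternating, so it is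
solvable, and the solutions `eᵀ c` form a coset of the symmetric matrices. Hence `e`, `h`, `d` and a
symmetric `s` are free parameters. -/
theorem card_pairIsom_hypForm_degForm [Finite F] [CharP F 2] {A : Matrix μ μ F}
    {S : Matrix κ κ F} (hA : IsUnit A) (hAs : Aᵀ = A) (hAd : ∀ i, A i i = 0) (hS : IsUnit S) :
    Nat.card (pairIsom (hypForm κ A) (degForm μ S)) =
      Nat.card F ^ (Fintype.card κ * (Fintype.card κ + 1) / 2 + Fintype.card κ * Fintype.card μ) *
        Nat.card (isom S) * Nat.card (isom A) := by
  -- `T d` is a chosen particular solution for `eᵀ c`.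
  have hT : ∀ d : Matrix μ κ F, ∃ T : Matrix κ κ F, T + Tᵀ = dᵀ * A * d := fun d =>
    exists_add_transpose_eq (by simp only [transpose_mul, transpose_transpose, hAs,
      Matrix.mul_assoc]) (diag_conj_eq_zero hAs hAd d)
  choose T hT using hT
  have hinv : ∀ e ∈ isom S, e⁻¹ * e = 1 := fun e he =>
    Matrix.nonsing_inv_mul _ ((Matrix.isUnit_iff_isUnit_det _).1 (isUnit_of_mem_isom hS he))
  have hinv' : ∀ e ∈ isom S, e * e⁻¹ = 1 := fun e he =>
    Matrix.mul_nonsing_inv _ ((Matrix.isUnit_iff_isUnit_det _).1 (isUnit_of_mem_isom hS he))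
  have htr : ∀ e ∈ isom S, eᵀ * e⁻¹ᵀ = 1 := fun e he => by
    rw [← transpose_mul, hinv e he, transpose_one]
  let f : (isom S × isom A) × (Matrix μ κ F × {s : Matrix κ κ F // sᵀ = s}) →
      pairIsom (hypForm κ A) (degForm μ S) := fun p =>
    ⟨blocks₃ (p.1.1.1⁻¹ᵀ) (p.1.1.1⁻¹ᵀ * (T p.2.1 + p.2.2.1)) 0 p.1.1.1
      ((p.1.2.1ᵀ * A * p.2.1 * p.1.1.1⁻¹)ᵀ) 0 0 p.2.1 p.1.2.1, by
      obtain ⟨⟨⟨e, he⟩, ⟨h, hh⟩⟩, d, ⟨s, hs⟩⟩ := p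
      refine (blocks₃_mem_pairIsom_iff hA hAs hS _ _ _ _ _ _ _ _ _).2
        ⟨⟨rfl, rfl, rfl⟩, he, hh, ?_, ?_, ?_⟩
      · rw [transpose_transpose, hinv e he]
      · rw [transpose_transpose, Matrix.mul_assoc _ e⁻¹, hinv e he, Matrix.mul_one]
        exact matrix_add_self_eq_zero _
      · rw [← Matrix.mul_assoc, htr e he, Matrix.one_mul, transpose_mul, transpose_transpose,
          Matrix.mul_assoc _ e⁻¹, hinv e he, Matrix.mul_one, transpose_add, hs, ← hT d]
        rw [show T d + s + ((T d)ᵀ + s) + (T d + (T d)ᵀ) =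
          (T d + T d) + ((T d)ᵀ + (T d)ᵀ) + (s + s) by abel]
        simp only [matrix_add_self_eq_zero, add_zero]⟩
  have hf : Function.Bijective f := by
    constructor
    · rintro ⟨⟨⟨e, he⟩, ⟨h, hh⟩⟩, d, ⟨s, hs⟩⟩ ⟨⟨⟨e', he'⟩, ⟨h', hh'⟩⟩, d', ⟨s', hs'⟩⟩ heq
      obtain ⟨⟨-, hc, -, rfl⟩, -, ⟨-, rfl⟩, rfl⟩ := blocks₃_inj.1 (congrArg Subtype.val heq)
      have := congrArg (fun M => eᵀ * M) hc
      simp only [← Matrix.mul_assoc, htr e he, Matrix.one_mul, add_right_inj] at this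
      subst this
      rfl
    · rintro ⟨X, hX⟩
      obtain ⟨a, c, z, e, b, z', z'', d, h, rfl⟩ := exists_eq_blocks₃ X
      obtain ⟨⟨rfl, rfl, rfl⟩, he, hh, ha, hb, hc⟩ :=
        (blocks₃_mem_pairIsom_iff hA hAs hS _ _ _ _ _ _ _ _ _).1 hX
      have hinve := hinv' e he
      have htre : e⁻¹ᵀ * eᵀ = 1 := by rw [← transpose_mul, hinve, transpose_one]
      -- The symmetric parameter is the difference `eᵀ c - T d`, written with a plus sign in
      -- characteristic 2.
      refine ⟨⟨⟨⟨e, he⟩, ⟨h, hh⟩⟩, d, ⟨eᵀ * c + T d, ?_⟩⟩, Subtype.ext ?_⟩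
      · rw [← hT d, show eᵀ * c + cᵀ * e + (T d + (T d)ᵀ) =
          (cᵀ * e + (T d)ᵀ) + (eᵀ * c + T d) by abel, matrix_add_eq_zero_iff] at hc
        rw [← hc, transpose_add, transpose_mul, transpose_transpose]
        exact hc.symm ▸ rfl
      · refine blocks₃_inj.2 ⟨⟨?_, ?_, rfl, rfl⟩, ⟨?_, rfl⟩, ⟨rfl, rfl⟩, rfl⟩
        · have := congrArg (fun M => (M * e⁻¹)ᵀ) ha
          simpa [Matrix.mul_assoc, hinve] using this.symm
        · show e⁻¹ᵀ * (T d + (eᵀ * c + T d)) = c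
          rw [show T d + (eᵀ * c + T d) = eᵀ * c + (T d + T d) by abel, matrix_add_self_eq_zero,
            add_zero, ← Matrix.mul_assoc, htre, Matrix.one_mul]
        · show (hᵀ * A * d * e⁻¹)ᵀ = b
          rw [← matrix_add_eq_zero_iff.1 hb, Matrix.mul_assoc, hinve, Matrix.mul_one,
            transpose_transpose]
  have hMat : Nat.card (Matrix μ κ F) = Nat.card F ^ (Fintype.card κ * Fintype.card μ) := by
    rw [show Nat.card (Matrix μ κ F) = Nat.card (μ → κ → F) from rfl, Nat.card_fun, Nat.card_fun,
      ← pow_mul, Nat.card_eq_fintype_card (α := κ), Nat.card_eq_fintype_card (α := μ)]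
  rw [← Nat.card_eq_of_bijective f hf, Nat.card_prod, Nat.card_prod, Nat.card_prod,
    card_isSymm_matrix, hMat, pow_add]
  ring

end Isometries

/-! ### The three model forms and the orders of their isometry groups -/

section NormalForms

variable {F : Type*} [Field F] {ι κ μ : Type*} [Fintype ι] [Fintype κ] [Fintype μ]
  [DecidableEq ι] [DecidableEq κ] [DecidableEq μ]

/-- The non-alternating symmetric form `diag(1, J)` of odd dimension. -/
def oddForm (F : Type*) [Field F] (k : ℕ) :
    Matrix (Unit ⊕ (Fin k ⊕ Fin k)) (Unit ⊕ (Fin k ⊕ Fin k)) F :=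
  fromBlocks 1 0 0 (J (Fin k) F)

/-- The non-alternating symmetric form `diag([[0, 1], [1, 1]], J)` of even dimension. -/
def evenForm (F : Type*) [Field F] (k : ℕ) :
    Matrix ((Unit ⊕ Unit) ⊕ (Fin k ⊕ Fin k)) ((Unit ⊕ Unit) ⊕ (Fin k ⊕ Fin k)) F :=
  hypForm Unit (J (Fin k) F) + degForm _ 1

theorem J_isSymm [CharP F 2] : (J κ F)ᵀ = J κ F := by
  rw [J_transpose, neg_eq_iff_add_eq_zero, matrix_add_self_eq_zero]

theorem J_diag (i : κ ⊕ κ) : J κ F i i = 0 := by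
  rcases i with i | i <;> simp [J]

theorem isUnit_J : IsUnit (J κ F) := (Matrix.isUnit_iff_isUnit_det _).2 (isUnit_det_J κ F)

/-- An isometry of an alternating form plus a square of a linear form preserves both. -/
theorem isom_add_vecMulVec [CharP F 2] {A : Matrix ι ι F} (hs : Aᵀ = A) (hd : ∀ i, A i i = 0)
    (l : ι → F) : isom (A + vecMulVec l l) = pairIsom A (vecMulVec l l) := by
  ext X
  have hmem : X ∈ isom (A + vecMulVec l l) ↔
    Xᵀ * (A + vecMulVec l l) * X = A + vecMulVec l l := Iff.rfl
  have hmem' : X ∈ pairIsom A (vecMulVec l l) ↔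
    Xᵀ * A * X = A ∧ Xᵀ * vecMulVec l l * X = vecMulVec l l := Iff.rfl
  rw [hmem, hmem', Matrix.mul_add, Matrix.add_mul]
  refine ⟨fun h => ?_, fun h => by rw [h.1, h.2]⟩
  have hX : Xᵀ * vecMulVec l l * X = vecMulVec (l ᵥ* X) (l ᵥ* X) := by
    rw [mul_vecMulVec, vecMulVec_mul, mulVec_transpose]
  -- The alternating part contributes nothing to the diagonal, which leaves `(l X)ᵢ² = lᵢ²`;
  -- squaring is injective in characteristic 2.
  have hl : l ᵥ* X = l := by
    ext i
    have h1 := congrFun₂ h i i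
    rw [Matrix.add_apply, Matrix.add_apply, diag_conj_eq_zero hs hd, hd, zero_add, zero_add, hX,
      vecMulVec_apply, vecMulVec_apply] at h1
    exact CharTwo.sq_injective (by simpa [sq] using h1)
  rw [hX, hl] at h ⊢
  exact ⟨add_right_cancel h, rfl⟩

theorem isUnit_hypForm {A : Matrix μ μ F} (hA : IsUnit A) : IsUnit (hypForm κ A) := by
  rw [hypForm, Matrix.isUnit_iff_isUnit_det, Matrix.det_fromBlocks_zero₂₁]
  refine IsUnit.mul ?_ ((Matrix.isUnit_iff_isUnit_det _).1 hA)
  rw [← Matrix.isUnit_iff_isUnit_det]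
  refine IsUnit.of_mul_eq_one (Matrix.fromBlocks 0 1 1 0) ?_
  simp [Matrix.fromBlocks_multiply]

theorem hypForm_isSymm {A : Matrix μ μ F} (hA : Aᵀ = A) : (hypForm κ A)ᵀ = hypForm κ A := by
  simp [hypForm, fromBlocks_transpose, hA]

theorem hypForm_diag {A : Matrix μ μ F} (hA : ∀ i, A i i = 0) (i) : hypForm κ A i i = 0 := by
  rcases i with (i | i) | i <;> simp [hypForm, hA]

theorem degForm_isSymm {S : Matrix κ κ F} (hS : Sᵀ = S) : (degForm μ S)ᵀ = degForm μ S := by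
  simp [degForm, fromBlocks_transpose, hS]

theorem isom_unit_one [CharP F 2] : Nat.card (isom (1 : Matrix Unit Unit F)) = 1 := by
  rw [Nat.card_eq_one_iff_unique]
  refine ⟨⟨fun X Y => Subtype.ext ?_⟩, ⟨1, by simp [isom]⟩⟩
  have key : ∀ X ∈ isom (1 : Matrix Unit Unit F), X = 1 := by
    intro X hX
    have hX : Xᵀ * 1 * X = 1 := hX
    have h := congrFun₂ hX () ()
    simp [Matrix.mul_apply] at h
    ext i j
    exact CharTwo.sq_injective (by simpa [sq] using h)
  rw [key X X.2, key Y Y.2]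

theorem card_isom_J (k : ℕ) : Nat.card (isom (J (Fin k) F)) = Nat.card (Sp k F) :=
  Nat.card_congr (Equiv.subtypeEquivRight fun _ => SymplecticGroup.mem_iff'.symm)

/-- The form is alternating plus the square of a coordinate, so its isometries preserve both
summands. The pair count with one-dimensional `κ` then applies and yields `q^(1 + 2k)`, the source
of the factor `q^(r-1)` in `B_r`. -/
theorem card_isom_evenForm [Finite F] [CharP F 2] (k : ℕ) :
    Nat.card (isom (evenForm F k)) = Nat.card F ^ (2 * k + 1) * Nat.card (Sp k F) := by
  have h : degForm (Fin k ⊕ Fin k) (1 : Matrix Unit Unit F) =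
      vecMulVec (Sum.elim (Sum.elim 0 1) 0) (Sum.elim (Sum.elim 0 1) 0) := by
    ext i j
    rcases i with (i | i) | i <;> rcases j with (j | j) | j <;>
      simp [degForm, vecMulVec_apply]
  rw [evenForm, h, isom_add_vecMulVec (hypForm_isSymm J_isSymm) (hypForm_diag J_diag), ← h,
    card_pairIsom_hypForm_degForm isUnit_J J_isSymm J_diag isUnit_one, isom_unit_one, card_isom_J]
  simp
  ring_nf
  simp

theorem card_pairIsom_fromBlocks {A : Matrix μ μ F} {S : Matrix κ κ F} (hA : IsUnit A)
    (hS : IsUnit S) :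
    Nat.card (pairIsom (fromBlocks 0 0 0 A) (fromBlocks S 0 0 0)) =
      Nat.card (isom S) * Nat.card (isom A) := by
  have hmem : ∀ (a : Matrix κ κ F) (b : Matrix κ μ F) (c : Matrix μ κ F) (d : Matrix μ μ F),
      fromBlocks a b c d ∈ pairIsom (fromBlocks 0 0 0 A) (fromBlocks S 0 0 0) ↔
        aᵀ * S * a = S ∧ dᵀ * A * d = A ∧ b = 0 ∧ c = 0 := by
    intro a b c d
    have : fromBlocks a b c d ∈ pairIsom (fromBlocks 0 0 0 A) (fromBlocks S 0 0 0) ↔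
      (fromBlocks a b c d)ᵀ * fromBlocks 0 0 0 A * fromBlocks a b c d = fromBlocks 0 0 0 A ∧
      (fromBlocks a b c d)ᵀ * fromBlocks S 0 0 0 * fromBlocks a b c d = fromBlocks S 0 0 0 :=
      Iff.rfl
    rw [this]
    simp only [fromBlocks_transpose, fromBlocks_multiply, Matrix.mul_zero, Matrix.zero_mul,
      zero_add, add_zero, fromBlocks_inj]
    constructor
    · rintro ⟨⟨-, -, h1, h2⟩, h3, h4, -, -⟩
      have u1 : IsUnit (aᵀ * S) := isUnit_of_mul_isUnit_left (h3 ▸ hS)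
      have u2 : IsUnit (dᵀ * A) := isUnit_of_mul_isUnit_left (h2 ▸ hA)
      refine ⟨h3, h2, ?_, ?_⟩
      · have := congrArg (fun M => (aᵀ * S)⁻¹ * M) h4
        rwa [Matrix.mul_zero, Matrix.nonsing_inv_mul_cancel_left _ _
          ((Matrix.isUnit_iff_isUnit_det _).1 u1)] at this
      · have := congrArg (fun M => (dᵀ * A)⁻¹ * M) h1
        rwa [Matrix.mul_zero, Matrix.nonsing_inv_mul_cancel_left _ _
          ((Matrix.isUnit_iff_isUnit_det _).1 u2)] at this
    · rintro ⟨h1, h2, rfl, rfl⟩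
      simp [h1, h2]
  rw [← Nat.card_prod]
  refine (Nat.card_eq_of_bijective (fun p : isom S × isom A =>
    (⟨fromBlocks p.1.1 0 0 p.2.1, (hmem _ _ _ _).2 ⟨p.1.2, p.2.2, rfl, rfl⟩⟩ :
      pairIsom (fromBlocks 0 0 0 A) (fromBlocks S 0 0 0))) ⟨?_, ?_⟩).symm
  · rintro ⟨a, d⟩ ⟨a', d'⟩ h
    obtain ⟨h1, -, -, h2⟩ := fromBlocks_inj.1 (congrArg Subtype.val h)
    exact Prod.ext (Subtype.ext h1) (Subtype.ext h2)
  · rintro ⟨X, hX⟩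
    rw [← fromBlocks_toBlocks X, hmem] at hX
    refine ⟨⟨⟨_, hX.1⟩, ⟨_, hX.2.1⟩⟩, Subtype.ext ?_⟩
    show fromBlocks _ _ _ _ = X
    conv_rhs => rw [← fromBlocks_toBlocks X, hX.2.2.1, hX.2.2.2]

/-- Isometries preserve both the alternating part and the square of the first coordinate, hence are
block diagonal, with trivial action on the line. -/
theorem card_isom_oddForm [CharP F 2] (k : ℕ) :
    Nat.card (isom (oddForm F k)) = Nat.card (Sp k F) := by
  have h : (fromBlocks 1 0 0 0 : Matrix (Unit ⊕ (Fin k ⊕ Fin k)) (Unit ⊕ (Fin k ⊕ Fin k)) F) =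
      vecMulVec (Sum.elim 1 0) (Sum.elim 1 0) := by
    ext i j
    rcases i with i | i <;> rcases j with j | j <;> simp [vecMulVec_apply]
  have h' : oddForm F k = fromBlocks 0 0 0 (J (Fin k) F) + fromBlocks 1 0 0 0 := by
    rw [fromBlocks_add]; simp [oddForm]
  rw [h', h, isom_add_vecMulVec, ← h, card_pairIsom_fromBlocks isUnit_J isUnit_one, isom_unit_one,
    card_isom_J, one_mul]
  · rw [fromBlocks_transpose, J_isSymm]; simp
  · rintro (i | i) <;> simp [J_diag]

theorem oddForm_isSymm [CharP F 2] (k : ℕ) : (oddForm F k)ᵀ = oddForm F k := by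
  rw [oddForm, fromBlocks_transpose, J_isSymm]; simp

theorem evenForm_isSymm [CharP F 2] (k : ℕ) : (evenForm F k)ᵀ = evenForm F k := by
  rw [evenForm, transpose_add, hypForm_isSymm J_isSymm, degForm_isSymm transpose_one]

theorem isUnit_oddForm (k : ℕ) : IsUnit (oddForm F k) := by
  rw [oddForm, Matrix.isUnit_iff_isUnit_det, Matrix.det_fromBlocks_zero₂₁]
  simpa using isUnit_det_J (Fin k) F

theorem isUnit_evenForm [CharP F 2] (k : ℕ) : IsUnit (evenForm F k) := by
  rw [evenForm, hypForm, degForm, fromBlocks_add, fromBlocks_add, Matrix.isUnit_iff_isUnit_det]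
  simp only [add_zero, zero_add, Matrix.det_fromBlocks_zero₂₁]
  refine IsUnit.mul ?_ (isUnit_det_J (Fin k) F)
  rw [← Matrix.isUnit_iff_isUnit_det]
  refine IsUnit.of_mul_eq_one (Matrix.fromBlocks 1 1 1 0) ?_
  simp [Matrix.fromBlocks_multiply, matrix_add_self_eq_zero]

end NormalForms

/-! ### Nondegenerate symmetric forms in characteristic 2 -/

section Classification

variable {F V : Type*} [Field F] [CharP F 2] [AddCommGroup V] [Module F V] [FiniteDimensional F V]
  (B : LinearMap.BilinForm F V)

theorem exists_gramMatrix_eq_J (hB : ∀ x, (∀ y, B x y = 0) → x = 0)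
    (hs : ∀ x y, B x y = B y x) (halt : ∀ x, B x x = 0) :
    ∃ (k : ℕ) (v : Fin k ⊕ Fin k → V), gramMatrix B v v = J (Fin k) F ∧
      2 * k = Module.finrank F V := by
  obtain ⟨k, u, -, hu, hk⟩ := exists_symplectic_family B hB hs (κ := Empty) Empty.elim
    (by rw [Matrix.isUnit_iff_isUnit_det]; simp) fun x _ => halt x
  exact ⟨k, u, hu, by simpa using hk⟩

/-- The map `x ↦ B x x` is additive, as the cross terms cancel, and scales by `c²`. Its square root
under the inverse Frobenius is therefore a linear functional, represented by some `u` by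
nondegeneracy. -/
theorem exists_form_self_eq_sq [Finite F] (hB : ∀ x, (∀ y, B x y = 0) → x = 0)
    (hs : ∀ x y, B x y = B y x) : ∃ u, ∀ x, B x x = B u x ^ 2 := by
  have : Fact (Nat.Prime 2) := ⟨Nat.prime_two⟩
  let l : V →ₗ[F] F :=
    { toFun := fun x => (frobeniusEquiv F 2).symm (B x x)
      map_add' := fun x y => by
        rw [← map_add]
        congr 1
        simp only [map_add, LinearMap.add_apply, hs y x]
        rw [show B x x + B x y + (B x y + B y y) = B x x + B y y + (B x y + B x y) by ring,
          CharTwo.add_self_eq_zero, add_zero]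
      map_smul' := fun c x => by
        have h : B (c • x) (c • x) = frobeniusEquiv F 2 c * B x x := by
          simp [frobenius_def, sq, mul_assoc]
        rw [h, map_mul, RingEquiv.symm_apply_apply]
        rfl }
  have hl : ∀ x, l x ^ 2 = B x x := fun x => (frobeniusEquiv F 2).apply_symm_apply (B x x)
  have hinj : Function.Injective B := by
    rw [← LinearMap.ker_eq_bot, LinearMap.ker_eq_bot']
    exact fun x hx => hB x fun y => by rw [hx]; rfl
  obtain ⟨u, hu⟩ := (LinearMap.injective_iff_surjective_of_finrank_eq_finrank
    (Subspace.dual_finrank_eq (K := F) (V := V)).symm).1 hinj l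
  exact ⟨u, fun x => by rw [hu, hl]⟩

/-- With `B x x = B u x ^ 2`, the form is alternating on the complement of any family containing
`u`. Either `B u u ≠ 0`, which forces `B u u = 1` and splits off a line, or `u` is isotropic and a
partner `w` with `B u w = 1` automatically has `B w w = 1`. -/
theorem exists_gramMatrix_eq_oddForm_or_evenForm [Finite F]
    (hB : ∀ x, (∀ y, B x y = 0) → x = 0) (hs : ∀ x y, B x y = B y x)
    (hna : ¬ ∀ x, B x x = 0) :
    (∃ (k : ℕ) (v : Unit ⊕ (Fin k ⊕ Fin k) → V), gramMatrix B v v = oddForm F k ∧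
      2 * k + 1 = Module.finrank F V) ∨
    (∃ (k : ℕ) (v : (Unit ⊕ Unit) ⊕ (Fin k ⊕ Fin k) → V), gramMatrix B v v = evenForm F k ∧
      2 * k + 2 = Module.finrank F V) := by
  obtain ⟨u, hu⟩ := exists_form_self_eq_sq B hB hs
  have glue : ∀ {κ : Type} [Fintype κ] [DecidableEq κ] (v : κ → V) (i₀ : κ), v i₀ = u →
      IsUnit (gramMatrix B v v) → ∃ (k : ℕ) (w : Fin k ⊕ Fin k → V),
        gramMatrix B (Sum.elim v w) (Sum.elim v w) =
          fromBlocks (gramMatrix B v v) 0 0 (J (Fin k) F) ∧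
        Fintype.card κ + 2 * k = Module.finrank F V := by
    intro κ _ _ v i₀ hi₀ hG
    obtain ⟨k, w, h1, h2, h3⟩ := exists_symplectic_family B hB hs v hG fun x hx => by
      rw [hu, ← hi₀, hx, sq, zero_mul]
    refine ⟨k, w, ?_, h3⟩
    have h1' : ∀ i j, B (v i) (w j) = 0 := fun i j => congrFun₂ h1 i j
    have h2' : ∀ i j, B (w i) (w j) = J (Fin k) F i j := fun i j => congrFun₂ h2 i j
    have h1'' : ∀ i j, B (w j) (v i) = 0 := fun i j => (hs _ _).trans (h1' i j)
    ext i j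
    rcases i with i | i <;> rcases j with j | j <;> simp [h1', h1'', h2']
  by_cases huu : B u u = 0
  · right
    have hu0 : u ≠ 0 := by
      rintro rfl
      exact hna fun x => by simp [hu x]
    obtain ⟨y, hy⟩ : ∃ y, B u y ≠ 0 := by
      by_contra! h
      exact hu0 (hB u h)
    set w := (B u y)⁻¹ • y with hw
    have huw : B u w = 1 := by simp [hw, hy]
    have hwu : B w u = 1 := (hs _ _).trans huw
    have hww : B w w = 1 := by rw [hu, huw, one_pow]
    have hG : gramMatrix B (Sum.elim (fun _ : Unit => u) fun _ : Unit => w)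
        (Sum.elim (fun _ : Unit => u) fun _ : Unit => w) = fromBlocks 0 1 1 1 := by
      ext i j
      rcases i with i | i <;> rcases j with j | j <;> simp [huu, huw, hwu, hww]
    obtain ⟨k, z, h1, h2⟩ := glue (Sum.elim (fun _ : Unit => u) fun _ : Unit => w)
      (Sum.inl ()) rfl (by
        rw [hG]
        refine IsUnit.of_mul_eq_one (Matrix.fromBlocks 1 1 1 0) ?_
        simp [Matrix.fromBlocks_multiply, matrix_add_self_eq_zero])
    refine ⟨k, _, h1.trans ?_, by simp at h2; omega⟩
    rw [hG, evenForm, hypForm, degForm, fromBlocks_add, fromBlocks_add]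
    simp
  · left
    have huu1 : B u u = 1 := by
      have := hu u
      rw [sq] at this
      exact (mul_eq_left₀ huu).1 this.symm
    have hG : gramMatrix B (fun _ : Unit => u) (fun _ : Unit => u) = 1 := by
      ext i j
      simp [huu1]
    obtain ⟨k, z, h1, h2⟩ := glue (fun _ : Unit => u) () rfl (by rw [hG]; exact isUnit_one)
    refine ⟨k, _, h1.trans ?_, by simp at h2; omega⟩
    rw [hG, oddForm]

end Classification

/-! ### A basis adapted to `ω` and a square-zero `N` -/

section AdaptedFamilies

variable {F V : Type*} [Field F] [CharP F 2] [AddCommGroup V] [Module F V] [FiniteDimensional F V]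
  (ω : LinearMap.BilinForm F V) (N : V →ₗ[F] V)

/-- The form `(x, y) ↦ ω(x, N y)` on a subspace. -/
noncomputable def twistedForm (C : Submodule F V) : LinearMap.BilinForm F C :=
  ω.compl₁₂ C.subtype (N ∘ₗ C.subtype)

variable {ω N}

/-- A vector of `C` orthogonal to `C` under `ω(·, N ·)` is also orthogonal to `ker N`, so `N x`
pairs to zero with everything; then `x` lies in `ker N ∩ C = 0`. -/
theorem twistedForm_separating (hω : ∀ x, (∀ y, ω x y = 0) → x = 0)
    (hβ : ∀ x y, ω x (N y) = ω y (N x)) (hs : ∀ x y, ω x y = ω y x)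
    {C : Submodule F V} (hC : IsCompl (LinearMap.ker N) C) (x : C)
    (hx : ∀ y, twistedForm ω N C x y = 0) : x = 0 := by
  have hNx : N x = 0 := by
    refine hω _ fun y => ?_
    obtain ⟨k, hk, c, hc, rfl⟩ := Submodule.mem_sup.1 (hC.sup_eq_top ▸ Submodule.mem_top (x := y))
    have h1 : ω x (N c) = 0 := hx ⟨c, hc⟩
    rw [hs, hβ, map_add, LinearMap.mem_ker.1 hk, zero_add, h1]
  exact Subtype.ext ((Submodule.disjoint_def.1 hC.disjoint) x hNx x.2)

/-- The vectors `w` form a basis of the isotropic image of `N`, dual to `v`. A correction of `v` by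
elements of that image makes it isotropic without changing `N v`, and the complement of the
resulting hyperbolic space lies in `ker N`. -/
theorem exists_adapted_family (hω : ∀ x, (∀ y, ω x y = 0) → x = 0)
    (hs : ∀ x y, ω x y = ω y x) (ha : ∀ x, ω x x = 0) (hN : ∀ x, N (N x) = 0)
    (hβ : ∀ x y, ω x (N y) = ω y (N x)) {C : Submodule F V} (hC : IsCompl (LinearMap.ker N) C)
    {κ : Type} [Fintype κ] [DecidableEq κ] {S : Matrix κ κ F} (hS : IsUnit S) {v : κ → C}
    (hv : gramMatrix (twistedForm ω N C) v v = S) (hcard : Fintype.card κ = Module.finrank F C) :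
    ∃ (m : ℕ) (u : (κ ⊕ κ) ⊕ (Fin m ⊕ Fin m) → V),
      gramMatrix ω u u = hypForm κ (J (Fin m) F) ∧
      gramMatrix ω u (N ∘ u) = degForm _ S ∧
      2 * Fintype.card κ + 2 * m = Module.finrank F V := by
  have hv' : ∀ i j, ω (v i) (N (v j)) = S i j := fun i j => congrFun₂ hv i j
  have hdet := (Matrix.isUnit_iff_isUnit_det _).1 hS
  -- The coefficients `S⁻¹` make `w` dual to `v` under `ω`.
  let w : κ → V := fun j => ∑ i, S⁻¹ i j • N (v i)
  have hNw : ∀ j, N (w j) = 0 := fun j => by simp [w, hN]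
  have hNv : ∀ j, N (v j) = ∑ i, S i j • w i := by
    intro j
    have h1 : ∀ k, ∑ i, S i j * S⁻¹ k i = (1 : Matrix κ κ F) k j := fun k => by
      rw [← Matrix.nonsing_inv_mul _ hdet, Matrix.mul_apply]
      exact Finset.sum_congr rfl fun _ _ => mul_comm _ _
    simp only [w, Finset.smul_sum, smul_smul]
    rw [Finset.sum_comm]
    simp only [← Finset.sum_smul, h1, Matrix.one_apply, ite_smul, one_smul, zero_smul]
    simp
  have hNN : ∀ x y, ω (N x) (N y) = 0 := fun x y => by rw [hβ, hN, map_zero]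
  have hww : ∀ i j, ω (w i) (w j) = 0 := fun i j => by simp [w, hNN]
  have hvw : ∀ i j, ω (v i) (w j) = (1 : Matrix κ κ F) i j := by
    intro i j
    rw [← Matrix.mul_nonsing_inv _ hdet, Matrix.mul_apply]
    simp [w, hv', mul_comm]
  have hwv : ∀ i j, ω (w i) (v j) = (1 : Matrix κ κ F) i j := fun i j => by
    rw [hs, hvw, Matrix.one_apply, Matrix.one_apply]
    simp only [eq_comm]
  obtain ⟨T, hT⟩ := exists_add_transpose_eq
    (A := gramMatrix ω (fun i => (v i : V)) (fun i => (v i : V)))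
    (by ext i j; exact hs _ _) fun i => ha _
  have hT' : ∀ i j, T i j + T j i = ω (v i) (v j) := fun i j => congrFun₂ hT i j
  -- Adding `T w` changes the Gram matrix of `v` by `T + Tᵀ`, which equals that matrix and so
  -- cancels it.
  let z : κ → V := fun j => v j + ∑ i, T i j • w i
  have hNz : ∀ j, N (z j) = N (v j) := fun j => by simp [z, hNw]
  have hwz : ∀ i j, ω (w i) (z j) = (1 : Matrix κ κ F) i j := fun i j => by
    simp [z, hww, hwv]
  have hzw : ∀ i j, ω (z i) (w j) = (1 : Matrix κ κ F) i j := fun i j => by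
    simp [z, hww, hvw]
  have hzz : ∀ i j, ω (z i) (z j) = 0 := fun i j => by
    have h1 : ω (z i) (v j) = ω (v i) (v j) + T j i := by
      simp [z, hwv, Matrix.one_apply]
    have h2 : ω (z i) (∑ k, T k j • w k) = T i j := by
      simp [hzw, Matrix.one_apply]
    rw [show z j = v j + ∑ k, T k j • w k from rfl, map_add, h1, h2, ← hT' i j,
      show T i j + T j i + T j i + T i j = (T i j + T i j) + (T j i + T j i) by ring,
      CharTwo.add_self_eq_zero, CharTwo.add_self_eq_zero, add_zero]
  have hG : gramMatrix ω (Sum.elim w z) (Sum.elim w z) = fromBlocks 0 1 1 0 := by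
    ext i j
    rcases i with i | i <;> rcases j with j | j <;> simp [hww, hwz, hzw, hzz]
  obtain ⟨m, u, h1, h2, h3⟩ := exists_symplectic_family ω hω hs (Sum.elim w z) (by
    rw [hG]
    refine IsUnit.of_mul_eq_one (Matrix.fromBlocks 0 1 1 0) ?_
    simp [Matrix.fromBlocks_multiply]) fun x _ => ha x
  have hwu : ∀ i j, ω (w i) (u j) = 0 := fun i j => congrFun₂ h1 (Sum.inl i) j
  have hzu : ∀ i j, ω (z i) (u j) = 0 := fun i j => congrFun₂ h1 (Sum.inr i) j
  have huw : ∀ i j, ω (u j) (w i) = 0 := fun i j => (hs _ _).trans (hwu i j)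
  have huz : ∀ i j, ω (u j) (z i) = 0 := fun i j => (hs _ _).trans (hzu i j)
  have huu : ∀ i j, ω (u i) (u j) = J (Fin m) F i j := fun i j => congrFun₂ h2 i j
  have hspan : ∀ y, ∃ c : κ → F, N y = ∑ i, c i • w i := by
    intro y
    obtain ⟨k, hk, x, hx, rfl⟩ := Submodule.mem_sup.1 (hC.sup_eq_top ▸ Submodule.mem_top (x := y))
    have hli := linearIndependent_of_isUnit_gramMatrix (twistedForm ω N C) v (hv ▸ hS)
    have htop := hli.span_eq_top_of_card_eq_finrank' hcard
    have hxs : (⟨x, hx⟩ : C) ∈ Submodule.span F (Set.range v) := htop ▸ Submodule.mem_top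
    obtain ⟨c, hc⟩ := (Submodule.mem_span_range_iff_exists_fun F).1 hxs
    have hc' : x = ∑ j, c j • (v j : V) := by
      have := congrArg Subtype.val hc
      simpa using this.symm
    refine ⟨fun i => ∑ j, c j * S i j, ?_⟩
    rw [map_add, LinearMap.mem_ker.1 hk, zero_add, hc', map_sum]
    simp only [map_smul, hNv, Finset.smul_sum, smul_smul, Finset.sum_smul]
    exact Finset.sum_comm
  -- `ω(N u, y) = ω(u, N y)` vanishes because `N y` lies in the span of `w`, orthogonal to `u`.
  have hNu : ∀ j, N (u j) = 0 := by
    intro j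
    refine hω _ fun y => ?_
    obtain ⟨c, hc⟩ := hspan y
    rw [hs, hβ, hc]
    simp [huw]
  have hwN : ∀ i y, ω (w i) (N y) = 0 := fun i y => by rw [hβ, hNw, map_zero]
  have huN : ∀ i y, ω (u i) (N y) = 0 := fun i y => by rw [hβ, hNu, map_zero]
  have hzv : ∀ i j, ω (z i) (N (v j)) = S i j := fun i j => by rw [hβ, hNz, ← hβ, hv']
  refine ⟨m, Sum.elim (Sum.elim w z) u, ?_, ?_, by simp at h3; omega⟩
  · ext i j
    rcases i with (i | i) | i <;> rcases j with (j | j) | j <;>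
      simp [hypForm, hww, hwz, hzw, hzz, hwu, hzu, huw, huz, huu]
  · ext i j
    rcases i with (i | i) | i <;> rcases j with (j | j) | j <;>
      simp [degForm, hNw, hNu, hNz, hwN, huN, hzv]

end AdaptedFamilies

/-! ### Normal forms, conjugacy classes and centralizers of involutions -/

section SymplecticInvolutions

variable {F : Type*} [Field F] [CharP F 2] {n : ℕ}

theorem transpose_mul_mul_apply {ι κ : Type*} [Fintype ι] (M : Matrix ι ι F) (P : Matrix ι κ F)
    (i j : κ) : (Pᵀ * M * P) i j = (fun a => P a i) ⬝ᵥ M *ᵥ fun a => P a j := by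
  rw [Matrix.mul_assoc]
  rfl

/-- The pair of forms `(ω, β_g)` has Gram matrices `hypForm κ J` and `degForm S` in some basis. -/
def HasNormalForm (g : Sp n F) {κ : Type} [Fintype κ] [DecidableEq κ] (S : Matrix κ κ F) (m : ℕ) :
    Prop :=
  ∃ (P : Matrix (Fin n ⊕ Fin n) ((κ ⊕ κ) ⊕ (Fin m ⊕ Fin m)) F)
    (Q : Matrix ((κ ⊕ κ) ⊕ (Fin m ⊕ Fin m)) (Fin n ⊕ Fin n) F), P * Q = 1 ∧ Q * P = 1 ∧
    Pᵀ * J (Fin n) F * P = hypForm κ (J (Fin m) F) ∧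
    Pᵀ * (J (Fin n) F * (g.1 - 1)) * P = degForm (Fin m ⊕ Fin m) S

theorem transpose_mul_J_mul (g : Sp n F) : g.1ᵀ * J (Fin n) F * g.1 = J (Fin n) F :=
  SymplecticGroup.mem_iff'.1 g.2

theorem coe_mul_self {g : Sp n F} (hg : g ∈ spInvolutions n F) : g.1 * g.1 = 1 := by
  have h : g ^ 2 = 1 := hg
  simpa [sq] using congrArg Subtype.val h

theorem sub_one_mul_self {g : Sp n F} (hg : g ∈ spInvolutions n F) :
    (g.1 - 1) * (g.1 - 1) = 0 := by
  rw [Matrix.mul_sub, Matrix.sub_mul, coe_mul_self hg, Matrix.mul_one, Matrix.one_mul,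
    sub_sub_eq_add_sub, sub_eq_zero, ← matrix_add_eq_zero_iff]
  rw [show (1 : Matrix (Fin n ⊕ Fin n) (Fin n ⊕ Fin n) F) - g.1 + 1 + g.1 = 1 + 1 by abel]
  exact matrix_add_self_eq_zero _

theorem attachedMatrix_isSymm {g : Sp n F} (hg : g ∈ spInvolutions n F) :
    (J (Fin n) F * (g.1 - 1))ᵀ = J (Fin n) F * (g.1 - 1) := by
  have h : g.1ᵀ * J (Fin n) F = J (Fin n) F * g.1 := by
    conv_rhs => rw [← transpose_mul_J_mul g, Matrix.mul_assoc, coe_mul_self hg, Matrix.mul_one]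
  rw [transpose_mul, transpose_sub, transpose_one, J_isSymm, Matrix.sub_mul, h, Matrix.mul_sub,
    Matrix.one_mul, Matrix.mul_one]

theorem bilin_symm {ι : Type*} [Fintype ι] {M : Matrix ι ι F} (hM : Mᵀ = M) (x y : ι → F) :
    x ⬝ᵥ M *ᵥ y = y ⬝ᵥ M *ᵥ x := by
  rw [dotProduct_mulVec, ← mulVec_transpose, hM, dotProduct_comm]

theorem bilin_alt {ι : Type*} [Fintype ι] {M : Matrix ι ι F} (hM : Mᵀ = M) (hd : ∀ i, M i i = 0)
    (x : ι → F) : x ⬝ᵥ M *ᵥ x = 0 := by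
  classical
  rw [← diag_conj_eq_zero hM hd (Matrix.of fun i (_ : Unit) => x i) (), transpose_mul_mul_apply]
  rfl

theorem toBilin'_J_separating (x : Fin n ⊕ Fin n → F)
    (h : ∀ y, toBilin' (J (Fin n) F) x y = 0) : x = 0 := by
  have h1 : x ᵥ* J (Fin n) F = 0 := dotProduct_eq_zero _ fun y => by
    rw [← dotProduct_mulVec, ← toBilin'_apply']
    exact h y
  have := congrArg (fun v => v ᵥ* J (Fin n) F) h1
  simpa only [vecMul_vecMul, J_squared, vecMul_neg, vecMul_one, zero_vecMul, neg_eq_zero]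
    using this

theorem attachedForm_isSymm {g : Sp n F} (hg : g ∈ spInvolutions n F) :
    (attachedForm g).IsSymm := ⟨fun x y => by
  rw [attachedForm, toBilin'_apply', toBilin'_apply', bilin_symm (attachedMatrix_isSymm hg)]⟩

theorem exists_inverse_of_conj {ι κ : Type*} [Fintype ι] [Fintype κ] [DecidableEq ι]
    [DecidableEq κ] (h : Fintype.card ι = Fintype.card κ) {M : Matrix ι ι F} {M' : Matrix κ κ F}
    (hM' : IsUnit M') {P : Matrix ι κ F} (hP : Pᵀ * M * P = M') :
    ∃ Q : Matrix κ ι F, P * Q = 1 ∧ Q * P = 1 := by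
  have h1 : (M'⁻¹ * Pᵀ * M) * P = 1 := by
    rw [Matrix.mul_assoc, Matrix.mul_assoc, ← Matrix.mul_assoc Pᵀ, hP,
      Matrix.nonsing_inv_mul _ ((Matrix.isUnit_iff_isUnit_det _).1 hM')]
  exact ⟨_, (mul_eq_one_comm_of_card_eq _ _ _ h.symm).1 h1, h1⟩

theorem hasNormalForm_of_gramMatrix {g : Sp n F} (hg : g ∈ spInvolutions n F)
    {C : Submodule F (Fin n ⊕ Fin n → F)}
    (hC : IsCompl (LinearMap.ker (Matrix.mulVecLin (g.1 - 1))) C)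
    {κ : Type} [Fintype κ] [DecidableEq κ] {S : Matrix κ κ F} (hS : IsUnit S) {v : κ → C}
    (hv : gramMatrix (twistedForm (toBilin' (J (Fin n) F)) (Matrix.mulVecLin (g.1 - 1)) C) v v = S)
    (hcard : Fintype.card κ = Module.finrank F C) :
    ∃ m, n = Fintype.card κ + m ∧ HasNormalForm g S m := by
  have happ : ∀ x y, toBilin' (J (Fin n) F) x (Matrix.mulVecLin (g.1 - 1) y) =
      x ⬝ᵥ (J (Fin n) F * (g.1 - 1)) *ᵥ y := fun x y => by
    rw [toBilin'_apply', mulVecLin_apply, mulVec_mulVec]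
  obtain ⟨m, u, h1, h2, h3⟩ := exists_adapted_family toBilin'_J_separating
    (fun x y => by rw [toBilin'_apply', toBilin'_apply', bilin_symm J_isSymm])
    (fun x => by rw [toBilin'_apply', bilin_alt J_isSymm J_diag])
    (fun x => by rw [mulVecLin_apply, mulVecLin_apply, mulVec_mulVec, sub_one_mul_self hg,
      zero_mulVec])
    (fun x y => by rw [happ, happ, bilin_symm (attachedMatrix_isSymm hg)]) hC hS hv hcard
  have h3' : 2 * Fintype.card κ + 2 * m = 2 * n := by
    rw [h3]; simp; ring
  let P : Matrix (Fin n ⊕ Fin n) ((κ ⊕ κ) ⊕ (Fin m ⊕ Fin m)) F := Matrix.of fun i j => u j i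
  have hP : Pᵀ * J (Fin n) F * P = hypForm κ (J (Fin m) F) := by
    rw [← h1]
    ext i j
    rw [transpose_mul_mul_apply, gramMatrix_apply, toBilin'_apply']
    rfl
  obtain ⟨Q, hPQ, hQP⟩ := exists_inverse_of_conj (by simp; omega) (isUnit_hypForm isUnit_J) hP
  refine ⟨m, by omega, P, Q, hPQ, hQP, hP, ?_⟩
  rw [← h2]
  ext i j
  rw [transpose_mul_mul_apply, gramMatrix_apply, Function.comp_apply, happ]
  rfl

theorem exists_hasNormalForm [Finite F] {g : Sp n F} (hg : g ∈ spInvolutions n F) :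
    (∃ k m, fixRank g = 2 * k ∧ n = 2 * k + m ∧ HasNormalForm g (J (Fin k) F) m) ∨
    (∃ k m, fixRank g = 2 * k + 1 ∧ n = (2 * k + 1) + m ∧ HasNormalForm g (oddForm F k) m) ∨
    (∃ k m, fixRank g = 2 * k + 2 ∧ n = (2 * k + 2) + m ∧ HasNormalForm g (evenForm F k) m) := by
  obtain ⟨C, hC⟩ := exists_isCompl (LinearMap.ker (Matrix.mulVecLin (g.1 - 1)))
  have hrank : fixRank g = Module.finrank F C := by
    have h1 := Submodule.finrank_add_eq_of_isCompl hC
    have h2 := LinearMap.finrank_range_add_finrank_ker (Matrix.mulVecLin (g.1 - 1))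
    rw [fixRank, Matrix.rank]
    omega
  have happ : ∀ x y, toBilin' (J (Fin n) F) x (Matrix.mulVecLin (g.1 - 1) y) =
      x ⬝ᵥ (J (Fin n) F * (g.1 - 1)) *ᵥ y := fun x y => by
    rw [toBilin'_apply', mulVecLin_apply, mulVec_mulVec]
  have hβ : ∀ x y, toBilin' (J (Fin n) F) x (Matrix.mulVecLin (g.1 - 1) y) =
      toBilin' (J (Fin n) F) y (Matrix.mulVecLin (g.1 - 1) x) := fun x y => by
    rw [happ, happ, bilin_symm (attachedMatrix_isSymm hg)]
  have hsep := twistedForm_separating toBilin'_J_separating hβ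
    (fun x y => by rw [toBilin'_apply', toBilin'_apply', bilin_symm J_isSymm]) hC
  have hsym : ∀ x y, twistedForm (toBilin' (J (Fin n) F)) (Matrix.mulVecLin (g.1 - 1)) C x y =
    twistedForm (toBilin' (J (Fin n) F)) (Matrix.mulVecLin (g.1 - 1)) C y x := fun x y => hβ _ _
  by_cases halt : ∀ x, twistedForm (toBilin' (J (Fin n) F)) (Matrix.mulVecLin (g.1 - 1)) C x x = 0
  · left
    obtain ⟨k, v, hv, hk⟩ := exists_gramMatrix_eq_J _ hsep hsym halt
    obtain ⟨m, hm, h⟩ := hasNormalForm_of_gramMatrix hg hC isUnit_J hv (by simp; omega)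
    exact ⟨k, m, by omega, by simp at hm; omega, h⟩
  · right
    obtain ⟨k, v, hv, hk⟩ | ⟨k, v, hv, hk⟩ :=
      exists_gramMatrix_eq_oddForm_or_evenForm _ hsep hsym halt
    · obtain ⟨m, hm, h⟩ := hasNormalForm_of_gramMatrix hg hC (isUnit_oddForm k) hv
        (by simp; omega)
      exact .inl ⟨k, m, by omega, by simp at hm; omega, h⟩
    · obtain ⟨m, hm, h⟩ := hasNormalForm_of_gramMatrix hg hC (isUnit_evenForm k) hv
        (by simp; omega)
      exact .inr ⟨k, m, by omega, by simp at hm; omega, h⟩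

variable {κ : Type} [Fintype κ] [DecidableEq κ] {S : Matrix κ κ F} {m : ℕ}

theorem eq_conj_of_conj {ι κ : Type*} [Fintype ι] [Fintype κ] [DecidableEq ι]
    {M : Matrix ι ι F} {M' : Matrix κ κ F} {P : Matrix ι κ F}
    {Q : Matrix κ ι F} (hPQ : P * Q = 1) (h : Pᵀ * M * P = M') : M = Qᵀ * M' * Q := by
  have hQ : Qᵀ * Pᵀ = 1 := by rw [← transpose_mul, hPQ, transpose_one]
  calc M = (Qᵀ * Pᵀ) * M * (P * Q) := by rw [hQ, hPQ, Matrix.one_mul, Matrix.mul_one]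
    _ = Qᵀ * M' * Q := by rw [← h]; simp only [Matrix.mul_assoc]

theorem HasNormalForm.isAlt_iff {g : Sp n F} (h : HasNormalForm g S m) (hS : Sᵀ = S) :
    (attachedForm g).IsAlt ↔ ∀ i, S i i = 0 := by
  obtain ⟨P, Q, hPQ, -, -, h2⟩ := h
  constructor
  · intro ha i
    have h3 : degForm (Fin m ⊕ Fin m) S (Sum.inl (Sum.inr i)) (Sum.inl (Sum.inr i)) = S i i := rfl
    rw [← h3, ← h2, transpose_mul_mul_apply, ← toBilin'_apply']
    exact ha _
  · intro hd x
    have hE : ∀ i, degForm (Fin m ⊕ Fin m) S i i = 0 := by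
      rintro ((i | i) | i) <;> simp [degForm, hd]
    have hM := eq_conj_of_conj hPQ h2
    rw [attachedForm, toBilin'_apply']
    refine bilin_alt ?_ (fun i => ?_) x
    · rw [hM]
      simp only [transpose_mul, transpose_transpose, degForm_isSymm hS, Matrix.mul_assoc]
    · rw [hM]
      exact diag_conj_eq_zero (degForm_isSymm hS) hE Q i

theorem rank_degForm {μ : Type*} [Fintype μ] [DecidableEq μ] (hS : IsUnit S) :
    (degForm μ S).rank = Fintype.card κ := by
  let A : Matrix ((κ ⊕ κ) ⊕ μ) κ F := fromRows (fromRows 0 1) 0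
  have h1 : degForm μ S = A * S * Aᵀ := by
    ext i j
    rcases i with (i | i) | i <;> rcases j with (j | j) | j <;>
      simp [A, degForm, fromRows_mul, transpose_fromRows]
  have h2 : Aᵀ * A = 1 := by
    simp [A, transpose_fromRows, fromCols_mul_fromRows]
  apply le_antisymm
  · rw [h1]
    exact ((rank_mul_le_left _ _).trans (rank_mul_le_right _ _)).trans (rank_le_card_width _)
  · have h3 : S = Aᵀ * degForm μ S * A := by
      rw [h1]
      calc S = (Aᵀ * A) * S * (Aᵀ * A) := by rw [h2, Matrix.one_mul, Matrix.mul_one]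
        _ = _ := by simp only [Matrix.mul_assoc]
    rw [← rank_of_isUnit S hS]
    conv_lhs => rw [h3]
    exact (rank_mul_le_left _ _).trans (rank_mul_le_right _ _)

theorem HasNormalForm.fixRank_eq {g : Sp n F} (h : HasNormalForm g S m) (hS : IsUnit S) :
    fixRank g = Fintype.card κ := by
  obtain ⟨P, Q, hPQ, -, -, h2⟩ := h
  have hM := eq_conj_of_conj hPQ h2
  rw [← rank_degForm (μ := Fin m ⊕ Fin m) hS, fixRank]
  apply le_antisymm
  · have h3 : g.1 - 1 = -J (Fin n) F * (Qᵀ * degForm (Fin m ⊕ Fin m) S * Q) := by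
      rw [← hM, ← Matrix.mul_assoc, Matrix.neg_mul, J_squared, neg_neg, Matrix.one_mul]
    rw [h3]
    exact ((rank_mul_le_right _ _).trans (rank_mul_le_left _ _)).trans (rank_mul_le_right _ _)
  · rw [← h2]
    exact ((rank_mul_le_left _ _).trans (rank_mul_le_right _ _)).trans (rank_mul_le_right _ _)

theorem coe_inv_mul_coe (h : Sp n F) : (h⁻¹).1 * h.1 = 1 := congrArg Subtype.val (inv_mul_cancel h)

theorem coe_mul_coe_inv (h : Sp n F) : h.1 * (h⁻¹).1 = 1 := congrArg Subtype.val (mul_inv_cancel h)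

theorem HasNormalForm.conj {g : Sp n F} (hg : HasNormalForm g S m) (h : Sp n F) :
    HasNormalForm (h * g * h⁻¹) S m := by
  obtain ⟨P, Q, hPQ, hQP, h1, h2⟩ := hg
  have e1 := transpose_mul_J_mul h
  have e2 := coe_inv_mul_coe h
  have e3 := coe_mul_coe_inv h
  refine ⟨h.1 * P, Q * (h⁻¹).1, ?_, ?_, ?_, ?_⟩
  · rw [Matrix.mul_assoc, ← Matrix.mul_assoc P, hPQ, Matrix.one_mul, e3]
  · rw [Matrix.mul_assoc, ← Matrix.mul_assoc _ h.1, e2, Matrix.one_mul, hQP]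
  · rw [← h1, transpose_mul]
    conv_rhs => rw [← e1]
    simp only [Matrix.mul_assoc]
  · have e4 : ((h * g * h⁻¹ : Sp n F).1 - 1) * h.1 = h.1 * (g.1 - 1) := by
      show (h.1 * g.1 * (h⁻¹).1 - 1) * h.1 = _
      rw [Matrix.sub_mul, Matrix.mul_sub, Matrix.mul_assoc, e2, Matrix.one_mul, Matrix.mul_one,
        Matrix.mul_one]
    rw [← h2, transpose_mul]
    calc Pᵀ * h.1ᵀ * (J (Fin n) F * ((h * g * h⁻¹ : Sp n F).1 - 1)) * (h.1 * P)
        = Pᵀ * h.1ᵀ * J (Fin n) F * (((h * g * h⁻¹ : Sp n F).1 - 1) * h.1) * P := by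
          simp only [Matrix.mul_assoc]
      _ = Pᵀ * (h.1ᵀ * J (Fin n) F * h.1) * (g.1 - 1) * P := by
          rw [e4]; simp only [Matrix.mul_assoc]
      _ = _ := by rw [e1]; simp only [Matrix.mul_assoc]

/-- The change of basis `P' P⁻¹` carries `ω` to itself and the form of `g` to that of `g'`.
Cancelling the invertible `J` turns this into conjugation of `g - 1`. -/
theorem HasNormalForm.isConj {g g' : Sp n F} (hg : HasNormalForm g S m)
    (hg' : HasNormalForm g' S m) : IsConj g g' := by
  obtain ⟨P, Q, hPQ, hQP, h1, h2⟩ := hg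
  obtain ⟨P', Q', hPQ', hQP', h1', h2'⟩ := hg'
  have hmem : P' * Q ∈ symplecticGroup (Fin n) F := by
    rw [SymplecticGroup.mem_iff', transpose_mul]
    calc Qᵀ * P'ᵀ * J (Fin n) F * (P' * Q) = Qᵀ * (P'ᵀ * J (Fin n) F * P') * Q := by
          simp only [Matrix.mul_assoc]
      _ = J (Fin n) F := by rw [h1', ← eq_conj_of_conj hPQ h1]
  refine isConj_iff.2 ⟨⟨P' * Q, hmem⟩, ?_⟩
  rw [mul_inv_eq_iff_eq_mul]
  refine Subtype.ext ?_
  show P' * Q * g.1 = g'.1 * (P' * Q)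
  have hQt : Q'ᵀ * P'ᵀ = 1 := by rw [← transpose_mul, hPQ', transpose_one]
  have hJ : IsUnit (J (Fin n) F) := isUnit_J
  have key : J (Fin n) F * (P' * Q * (g.1 - 1)) = J (Fin n) F * ((g'.1 - 1) * (P' * Q)) := by
    calc J (Fin n) F * (P' * Q * (g.1 - 1))
        = (Q'ᵀ * P'ᵀ) * J (Fin n) F * (P' * Q * (g.1 - 1)) := by rw [hQt, Matrix.one_mul]
      _ = Q'ᵀ * (P'ᵀ * J (Fin n) F * P') * Q * (g.1 - 1) := by simp only [Matrix.mul_assoc]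
      _ = Q'ᵀ * Pᵀ * J (Fin n) F * (P * Q) * (g.1 - 1) := by
          rw [h1', ← h1]; simp only [Matrix.mul_assoc]
      _ = Q'ᵀ * Pᵀ * J (Fin n) F * (g.1 - 1) * (P * Q) := by
          rw [hPQ, Matrix.mul_one, Matrix.mul_one]
      _ = Q'ᵀ * (Pᵀ * (J (Fin n) F * (g.1 - 1)) * P) * Q := by simp only [Matrix.mul_assoc]
      _ = (Q'ᵀ * P'ᵀ) * (J (Fin n) F * (g'.1 - 1) * P' * Q) := by
          rw [h2, ← h2']; simp only [Matrix.mul_assoc]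
      _ = _ := by rw [hQt, Matrix.one_mul]; simp only [Matrix.mul_assoc]
  have := hJ.mul_right_injective key
  rwa [Matrix.mul_sub, Matrix.sub_mul, Matrix.mul_one, Matrix.one_mul, sub_left_inj] at this

theorem card_centralizer_eq_card_pairIsom (g : Sp n F) :
    Nat.card (Subgroup.centralizer {g}) =
      Nat.card (pairIsom (J (Fin n) F) (J (Fin n) F * (g.1 - 1))) := by
  have hcomm : ∀ X : Sp n F, X.1ᵀ * (J (Fin n) F * (g.1 - 1)) * X.1 = J (Fin n) F * (g.1 - 1) ↔
      g * X = X * g := by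
    intro X
    have hX := transpose_mul_J_mul X
    have hU : IsUnit (X.1ᵀ * J (Fin n) F) := isUnit_of_mul_isUnit_left (hX ▸ isUnit_J)
    -- With `J` written as `Xᵀ J X` on the right, the invertible factor `Xᵀ J` cancels and
    -- commutation with `g - 1` remains.
    conv_lhs => rhs; rw [← hX]
    rw [← Matrix.mul_assoc X.1ᵀ, Matrix.mul_assoc, Matrix.mul_assoc _ X.1]
    rw [hU.mul_right_inj, Matrix.sub_mul, Matrix.mul_sub, Matrix.mul_one, Matrix.one_mul,
      sub_left_inj]
    exact (Subtype.ext_iff (a1 := g * X) (a2 := X * g)).symm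
  refine Nat.card_congr
    { toFun := fun X => ⟨X.1.1, transpose_mul_J_mul X.1, (hcomm X.1).2
        (Subgroup.mem_centralizer_singleton_iff.1 X.2).symm⟩
      invFun := fun Y => ⟨⟨Y.1, SymplecticGroup.mem_iff'.2 Y.2.1⟩,
        Subgroup.mem_centralizer_singleton_iff.2 ((hcomm ⟨Y.1, _⟩).1 Y.2.2).symm⟩
      left_inv := fun X => rfl
      right_inv := fun Y => rfl }

theorem HasNormalForm.card_centralizer [Finite F] {g : Sp n F} (h : HasNormalForm g S m)
    (hS : IsUnit S) : Nat.card (Subgroup.centralizer {g}) =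
      Nat.card F ^ (Fintype.card κ * (Fintype.card κ + 1) / 2 + Fintype.card κ * (2 * m)) *
        Nat.card (isom S) * Nat.card (Sp m F) := by
  obtain ⟨P, Q, hPQ, hQP, h1, h2⟩ := h
  rw [card_centralizer_eq_card_pairIsom, ← card_pairIsom_congr _ _ hPQ hQP, h1, h2,
    card_pairIsom_hypForm_degForm isUnit_J J_isSymm J_diag hS, card_isom_J]
  rw [Fintype.card_sum, Fintype.card_fin, ← two_mul]

/-- A symplectic basis `U` for the model alternating form `Ω` transports the model form `E` to `β`
on the standard space, and `g = 1 + J β` since `J² = 1`. The identity `E Ω E = 0` becomes `β J β =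
0`, which gives both `g ∈ Sp` and `g² = 1`. -/
theorem exists_involution_hasNormalForm (hS : Sᵀ = S) (hn : n = Fintype.card κ + m) :
    ∃ g ∈ spInvolutions n F, HasNormalForm g S m := by
  let Ω := hypForm κ (J (Fin m) F)
  have hΩs : Ωᵀ = Ω := hypForm_isSymm J_isSymm
  obtain ⟨k, u, hu, hk⟩ := exists_gramMatrix_eq_J (toBilin' Ω)
    (fun x h => by
      have h1 : x ᵥ* Ω = 0 := dotProduct_eq_zero _ fun y => by
        rw [← dotProduct_mulVec, ← toBilin'_apply']
        exact h y
      have := congrArg (fun v => v ᵥ* Ω⁻¹) h1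
      simpa only [vecMul_vecMul, Matrix.mul_nonsing_inv _ ((Matrix.isUnit_iff_isUnit_det _).1
        (isUnit_hypForm isUnit_J)), vecMul_one, zero_vecMul, Ω] using this)
    (fun x y => by rw [toBilin'_apply', toBilin'_apply', bilin_symm hΩs])
    (fun x => by rw [toBilin'_apply', bilin_alt hΩs (hypForm_diag J_diag)])
  obtain rfl : k = n := by
    simp at hk
    omega
  let U : Matrix ((κ ⊕ κ) ⊕ (Fin m ⊕ Fin m)) (Fin k ⊕ Fin k) F := Matrix.of fun i j => u j i
  have hU : Uᵀ * Ω * U = J (Fin k) F := by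
    rw [← hu]
    ext i j
    rw [transpose_mul_mul_apply, gramMatrix_apply, toBilin'_apply']
    rfl
  obtain ⟨P, hUP, hPU⟩ := exists_inverse_of_conj (by simp; omega) isUnit_J hU
  let E := degForm (Fin m ⊕ Fin m) S
  have hEΩ : E * Ω * E = 0 := by
    simp [E, Ω, degForm, hypForm, fromBlocks_multiply]
  have hΩ2 : Ω * Ω = 1 := by
    have h1 : J (Fin m) F * J (Fin m) F = 1 := by
      rw [J_squared, neg_eq_iff_add_eq_zero, matrix_add_self_eq_zero]
    simp [Ω, hypForm, fromBlocks_multiply, h1]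
  have hJJ : J (Fin k) F * J (Fin k) F = 1 := by
    rw [J_squared, neg_eq_iff_add_eq_zero, matrix_add_self_eq_zero]
  have hUJU : U * J (Fin k) F * Uᵀ = Ω := by
    have hPt : Uᵀ * Pᵀ = 1 := by rw [← transpose_mul, hPU, transpose_one]
    calc U * J (Fin k) F * Uᵀ = U * J (Fin k) F * Uᵀ * (Ω * Ω) := by rw [hΩ2, Matrix.mul_one]
      _ = U * J (Fin k) F * Uᵀ * (Pᵀ * J (Fin k) F * P) * Ω := by
          rw [← eq_conj_of_conj hUP hU, Matrix.mul_assoc _ Ω]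
      _ = U * (J (Fin k) F * (Uᵀ * Pᵀ) * J (Fin k) F) * P * Ω := by simp only [Matrix.mul_assoc]
      _ = Ω := by rw [hPt, Matrix.mul_one, hJJ, Matrix.mul_one, hUP, Matrix.one_mul]
  let β := Uᵀ * E * U
  have hβs : βᵀ = β := by
    simp only [β, transpose_mul, transpose_transpose, degForm_isSymm hS, E, Matrix.mul_assoc]
  have hβJβ : β * J (Fin k) F * β = 0 := by
    calc β * J (Fin k) F * β = Uᵀ * E * (U * J (Fin k) F * Uᵀ) * E * U := by
          simp only [β, Matrix.mul_assoc]
      _ = Uᵀ * (E * Ω * E) * U := by rw [hUJU]; simp only [Matrix.mul_assoc]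
      _ = 0 := by rw [hEΩ, Matrix.mul_zero, Matrix.zero_mul]
  have hmem : 1 + J (Fin k) F * β ∈ symplecticGroup (Fin k) F := by
    rw [SymplecticGroup.mem_iff', transpose_add, transpose_mul, transpose_one, hβs, J_isSymm,
      Matrix.add_mul, Matrix.mul_assoc β, hJJ, Matrix.mul_one, Matrix.one_mul, Matrix.mul_add,
      Matrix.mul_one, Matrix.add_mul, ← Matrix.mul_assoc, hJJ, Matrix.one_mul,
      ← Matrix.mul_assoc, hβJβ, add_zero, add_assoc, matrix_add_self_eq_zero, add_zero]
  have hsub : J (Fin k) F * ((1 + J (Fin k) F * β) - 1) = β := by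
    rw [add_sub_cancel_left, ← Matrix.mul_assoc, hJJ, Matrix.one_mul]
  refine ⟨⟨_, hmem⟩, Subtype.ext ?_, P, U, hPU, hUP, ?_, ?_⟩
  · show (1 + J (Fin k) F * β) ^ 2 = 1
    rw [sq, Matrix.mul_add, Matrix.mul_one, Matrix.add_mul, Matrix.one_mul,
      show J (Fin k) F * β * (J (Fin k) F * β) = J (Fin k) F * (β * J (Fin k) F * β) by
        simp only [Matrix.mul_assoc], hβJβ, Matrix.mul_zero, add_zero, add_assoc,
      matrix_add_self_eq_zero, add_zero]
  · exact (eq_conj_of_conj hUP hU).symm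
  · show Pᵀ * (J (Fin k) F * ((1 + J (Fin k) F * β) - 1)) * P = E
    rw [hsub]
    exact (eq_conj_of_conj hUP rfl).symm

/-- The involutions with a given normal form are a single conjugacy class, so this is
orbit-stabilizer. -/
theorem ncard_mul_card_centralizer [Finite F] {g : Sp n F} (hg : g ∈ spInvolutions n F)
    (h : HasNormalForm g S m) :
    {g ∈ spInvolutions n F | HasNormalForm g S m}.ncard * Nat.card (Subgroup.centralizer {g}) =
      Nat.card (Sp n F) := by
  have hset : {g ∈ spInvolutions n F | HasNormalForm g S m} = MulAction.orbit (ConjAct (Sp n F)) g := by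
    ext x
    rw [ConjAct.mem_orbit_conjAct]
    constructor
    · exact fun hx => hx.2.isConj h
    · intro hx
      obtain ⟨c, rfl⟩ := isConj_iff.1 hx.symm
      refine ⟨?_, h.conj c⟩
      have hg : g ^ 2 = 1 := hg
      show (c * g * c⁻¹) ^ 2 = 1
      rw [conj_pow, hg, mul_one, mul_inv_cancel]
  rw [hset, ← MulAction.index_stabilizer, Subgroup.nat_card_centralizer_nat_card_stabilizer,
    Subgroup.index_mul_card]
  rfl

end SymplecticInvolutions

/-! ### Counting the classes -/

section Counting

variable {F : Type*} [Field F] [CharP F 2] {n k m : ℕ}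

theorem HasNormalForm.isAlt_of_J {g : Sp n F} (h : HasNormalForm g (J (Fin k) F) m) :
    (attachedForm g).IsAlt :=
  (h.isAlt_iff J_isSymm).2 J_diag

theorem HasNormalForm.not_isAlt_of_oddForm {g : Sp n F} (h : HasNormalForm g (oddForm F k) m) :
    ¬ (attachedForm g).IsAlt := fun ha => by
  simpa [oddForm] using (h.isAlt_iff (oddForm_isSymm k)).1 ha (Sum.inl ())

theorem HasNormalForm.not_isAlt_of_evenForm {g : Sp n F} (h : HasNormalForm g (evenForm F k) m) :
    ¬ (attachedForm g).IsAlt := fun ha => by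
  simpa [evenForm, hypForm, degForm] using
    (h.isAlt_iff (evenForm_isSymm k)).1 ha (Sum.inl (Sum.inr ()))

variable [Finite F]

theorem hasNormalForm_J_iff {g : Sp n F} (hg : g ∈ spInvolutions n F) (hn : n = 2 * k + m) :
    (fixRank g = 2 * k ∧ (attachedForm g).IsAlt) ↔ HasNormalForm g (J (Fin k) F) m := by
  constructor
  · rintro ⟨hr, ha⟩
    obtain ⟨k', m', hr', hn', h⟩ | ⟨k', m', hr', hn', h⟩ | ⟨k', m', hr', hn', h⟩ :=
      exists_hasNormalForm hg
    · obtain rfl : k' = k := by omega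
      obtain rfl : m' = m := by omega
      exact h
    · exact absurd ha h.not_isAlt_of_oddForm
    · exact absurd ha h.not_isAlt_of_evenForm
  · intro h
    exact ⟨by rw [h.fixRank_eq isUnit_J]; simp [two_mul], h.isAlt_of_J⟩

theorem hasNormalForm_evenForm_iff {g : Sp n F} (hg : g ∈ spInvolutions n F)
    (hn : n = (2 * k + 2) + m) :
    (fixRank g = 2 * k + 2 ∧ ¬ (attachedForm g).IsAlt) ↔ HasNormalForm g (evenForm F k) m := by
  constructor
  · rintro ⟨hr, ha⟩
    obtain ⟨k', m', hr', hn', h⟩ | ⟨k', m', hr', hn', h⟩ | ⟨k', m', hr', hn', h⟩ :=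
      exists_hasNormalForm hg
    · exact absurd h.isAlt_of_J ha
    · omega
    · obtain rfl : k' = k := by omega
      obtain rfl : m' = m := by omega
      exact h
  · intro h
    exact ⟨by rw [h.fixRank_eq (isUnit_evenForm k)]; simp; ring, h.not_isAlt_of_evenForm⟩

theorem hasNormalForm_oddForm_iff {g : Sp n F} (hg : g ∈ spInvolutions n F)
    (hn : n = (2 * k + 1) + m) :
    fixRank g = 2 * k + 1 ↔ HasNormalForm g (oddForm F k) m := by
  constructor
  · intro hr
    obtain ⟨k', m', hr', hn', h⟩ | ⟨k', m', hr', hn', h⟩ | ⟨k', m', hr', hn', h⟩ :=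
      exists_hasNormalForm hg
    · omega
    · obtain rfl : k' = k := by omega
      obtain rfl : m' = m := by omega
      exact h
    · omega
  · intro h
    rw [h.fixRank_eq (isUnit_oddForm k)]; simp; ring

theorem ncard_and_card_centralizer {κ : Type} [Fintype κ] [DecidableEq κ] {S : Matrix κ κ F}
    (hS : IsUnit S) (hSs : Sᵀ = S) (hn : n = Fintype.card κ + m) {p : Sp n F → Prop}
    (hp : ∀ g ∈ spInvolutions n F, p g ↔ HasNormalForm g S m) {c : ℕ}
    (hc : Nat.card F ^ (Fintype.card κ * (Fintype.card κ + 1) / 2 + Fintype.card κ * (2 * m)) *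
        Nat.card (isom S) * Nat.card (Sp m F) = c) :
    ({g ∈ spInvolutions n F | p g}.ncard : ℚ) = (spOrder F (2 * n) : ℚ) / (c : ℚ) ∧
      ∀ g ∈ spInvolutions n F, p g → Nat.card (Subgroup.centralizer {g}) = c := by
  have hset : {g ∈ spInvolutions n F | p g} = {g ∈ spInvolutions n F | HasNormalForm g S m} := by
    ext g
    exact and_congr_right (hp g)
  have hcent : ∀ g ∈ spInvolutions n F, p g → Nat.card (Subgroup.centralizer {g}) = c :=
    fun g hg hpg => (((hp g hg).1 hpg).card_centralizer hS).trans hc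
  refine ⟨?_, hcent⟩
  obtain ⟨g, hg, h⟩ := exists_involution_hasNormalForm (n := n) hSs hn
  have h1 := ncard_mul_card_centralizer hg h
  have h2 := hcent g hg ((hp g hg).2 h)
  have h3 : c ≠ 0 := h2 ▸ Nat.card_pos.ne'
  rw [hset, eq_div_iff (Nat.cast_ne_zero.2 h3), ← h2, spOrder, Nat.mul_div_cancel_left n two_pos,
    ← h1, Nat.cast_mul]

theorem involutions_alternating {r : ℕ} (hr : r ≤ n) (he : Even r) :
    ({g ∈ spInvolutions n F | fixRank g = r ∧ (attachedForm g).IsAlt}.ncard : ℚ) =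
        (spOrder F (2 * n) : ℚ) / (spA F n r : ℚ) ∧
      ∀ g ∈ spInvolutions n F, fixRank g = r ∧ (attachedForm g).IsAlt →
        Nat.card (Subgroup.centralizer {g}) = spA F n r := by
  obtain ⟨k, rfl⟩ := he.two_dvd
  obtain ⟨m, rfl⟩ := Nat.exists_eq_add_of_le hr
  refine ncard_and_card_centralizer (isUnit_J (κ := Fin k)) J_isSymm (by simp [two_mul])
    (fun g hg => hasNormalForm_J_iff hg rfl) ?_
  rw [card_isom_J, spA, spOrder, spOrder, Fintype.card_sum, Fintype.card_fin, ← two_mul,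
    show 2 * (2 * k + m) - 2 * (2 * k) = 2 * m by omega, Nat.mul_div_cancel_left k two_pos,
    Nat.mul_div_cancel_left m two_pos]

theorem involutions_not_alternating {r : ℕ} (hr : r ≤ n) (h1 : 1 ≤ r) (he : Even r) :
    ({g ∈ spInvolutions n F | fixRank g = r ∧ ¬ (attachedForm g).IsAlt}.ncard : ℚ) =
        (spOrder F (2 * n) : ℚ) / (spB F n r : ℚ) ∧
      ∀ g ∈ spInvolutions n F, fixRank g = r ∧ ¬ (attachedForm g).IsAlt →
        Nat.card (Subgroup.centralizer {g}) = spB F n r := by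
  -- The non-alternating even model uses two dimensions for its `[[0, 1], [1, 1]]` block, so `r - 2
  -- = 2k`.
  obtain ⟨k, rfl⟩ : ∃ k, r = 2 * k + 2 := by
    obtain ⟨l, rfl⟩ := he.two_dvd
    exact ⟨l - 1, by omega⟩
  obtain ⟨m, rfl⟩ := Nat.exists_eq_add_of_le hr
  have hcard : Fintype.card ((Unit ⊕ Unit) ⊕ (Fin k ⊕ Fin k)) = 2 * k + 2 := by simp; ring
  refine ncard_and_card_centralizer (isUnit_evenForm k) (evenForm_isSymm k) (by rw [hcard])
    (fun g hg => hasNormalForm_evenForm_iff hg rfl) ?_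
  rw [card_isom_evenForm, spB, spOrder, spOrder, hcard,
    show 2 * (2 * k + 2 + m) - 2 * (2 * k + 2) = 2 * m by omega, Nat.add_sub_cancel,
    Nat.mul_div_cancel_left k two_pos, Nat.mul_div_cancel_left m two_pos,
    show 2 * k + 2 - 1 = 2 * k + 1 by omega]
  ring

theorem involutions_odd {r : ℕ} (hr : r ≤ n) (ho : Odd r) :
    ({g ∈ spInvolutions n F | fixRank g = r}.ncard : ℚ) =
        (spOrder F (2 * n) : ℚ) / (spC F n r : ℚ) ∧
      ∀ g ∈ spInvolutions n F, fixRank g = r →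
        Nat.card (Subgroup.centralizer {g}) = spC F n r := by
  obtain ⟨k, rfl⟩ := ho
  obtain ⟨m, rfl⟩ := Nat.exists_eq_add_of_le hr
  have hcard : Fintype.card (Unit ⊕ (Fin k ⊕ Fin k)) = 2 * k + 1 := by simp; ring
  refine ncard_and_card_centralizer (isUnit_oddForm k) (oddForm_isSymm k) (by rw [hcard])
    (fun g hg => hasNormalForm_oddForm_iff hg rfl) ?_
  rw [card_isom_oddForm, spC, spOrder, spOrder, hcard,
    show 2 * (2 * k + 1 + m) - 2 * (2 * k + 1) = 2 * m by omega, Nat.add_sub_cancel,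
    Nat.mul_div_cancel_left k two_pos, Nat.mul_div_cancel_left m two_pos]

theorem fixRank_le {g : Sp n F} (hg : g ∈ spInvolutions n F) : fixRank g ≤ n := by
  obtain ⟨k, m, h, h', -⟩ | ⟨k, m, h, h', -⟩ | ⟨k, m, h, h', -⟩ := exists_hasNormalForm hg <;> omega

theorem not_isAlt_of_odd_fixRank {g : Sp n F} (hg : g ∈ spInvolutions n F)
    (ho : Odd (fixRank g)) : ¬ (attachedForm g).IsAlt := by
  obtain ⟨l, hl⟩ := ho
  obtain ⟨k, m, h, -, -⟩ | ⟨k, m, -, -, h⟩ | ⟨k, m, -, -, h⟩ := exists_hasNormalForm hg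
  · omega
  · exact h.not_isAlt_of_oddForm
  · exact h.not_isAlt_of_evenForm

theorem ncard_spInvolutions_eq_sum :
    (spInvolutions n F).ncard =
      (∑ r ∈ (Finset.Icc 0 n).filter Even,
        {g ∈ spInvolutions n F | fixRank g = r ∧ (attachedForm g).IsAlt}.ncard) +
      (∑ r ∈ (Finset.Icc 1 n).filter Even,
        {g ∈ spInvolutions n F | fixRank g = r ∧ ¬ (attachedForm g).IsAlt}.ncard) +
      (∑ r ∈ (Finset.Icc 1 n).filter Odd, {g ∈ spInvolutions n F | fixRank g = r}.ncard) := by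
  classical
  have := Fintype.ofFinite (Sp n F)
  have hcard : ∀ p : Sp n F → Prop, {g | p g}.ncard = (Finset.univ.filter p).card := fun p => by
    rw [← Set.ncard_coe_finset]
    simp
  have hI : (spInvolutions n F).ncard = (Finset.univ.filter (· ∈ spInvolutions n F)).card :=
    hcard _
  rw [hI, ← Finset.card_filter_add_card_filter_not (fun g => (attachedForm g).IsAlt),
    ← Finset.card_filter_add_card_filter_not
      (s := Finset.filter (fun g => ¬ (attachedForm g).IsAlt) _) (fun g => Even (fixRank g)),
    ← add_assoc]
  congr 1
  · congr 1
    · rw [Finset.card_eq_sum_card_fiberwise (f := fixRank)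
        (t := (Finset.Icc 0 n).filter Even)]
      · refine Finset.sum_congr rfl fun r _ => ?_
        rw [hcard, Finset.filter_filter, Finset.filter_filter]
        congr 1
        ext g
        simp
        tauto
      · intro g hg
        simp at hg
        simp only [Finset.coe_filter, Set.mem_ofPred_eq, Finset.mem_Icc]
        exact ⟨⟨Nat.zero_le _, fixRank_le hg.1⟩, Nat.not_odd_iff_even.1 fun ho =>
          not_isAlt_of_odd_fixRank hg.1 ho hg.2⟩
    · rw [Finset.card_eq_sum_card_fiberwise (f := fixRank)
        (t := (Finset.Icc 1 n).filter Even)]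
      · refine Finset.sum_congr rfl fun r hr => ?_
        have he := (Finset.mem_filter.1 hr).2
        rw [hcard, Finset.filter_filter, Finset.filter_filter, Finset.filter_filter]
        congr 1
        ext g
        simp only [Finset.mem_filter, Finset.mem_univ, true_and]
        refine ⟨by tauto, ?_⟩
        rintro ⟨h1, rfl, h2⟩
        tauto
      · intro g hg
        simp at hg
        simp only [Finset.coe_filter, Set.mem_ofPred_eq, Finset.mem_Icc]
        -- Rank 0 is excluded: both non-alternating models have positive rank.
        refine ⟨⟨Nat.one_le_iff_ne_zero.2 fun h0 => ?_, fixRank_le hg.1.1⟩, hg.2⟩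
        obtain ⟨k, m, -, -, h⟩ | ⟨k, m, h, -⟩ | ⟨k, m, h, -⟩ := exists_hasNormalForm hg.1.1
        · exact hg.1.2 h.isAlt_of_J
        · omega
        · omega
  · rw [Finset.card_eq_sum_card_fiberwise (f := fixRank)
      (t := (Finset.Icc 1 n).filter Odd)]
    · refine Finset.sum_congr rfl fun r hr => ?_
      have ho := (Finset.mem_filter.1 hr).2
      rw [hcard, Finset.filter_filter, Finset.filter_filter, Finset.filter_filter]
      congr 1
      ext g
      simp only [Finset.mem_filter, Finset.mem_univ, true_and, Nat.not_even_iff_odd]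
      refine ⟨by tauto, ?_⟩
      rintro ⟨h1, rfl⟩
      have := not_isAlt_of_odd_fixRank h1 ho
      tauto
    · intro g hg
      simp at hg
      simp only [Finset.coe_filter, Set.mem_ofPred_eq, Finset.mem_Icc]
      exact ⟨⟨hg.2.pos, fixRank_le hg.1.1⟩, hg.2⟩

end Counting

theorem charP_two_of_even_card (F : Type*) [Field F] [Finite F] (hq : Even (Nat.card F)) :
    CharP F 2 := by
  have := Fintype.ofFinite F
  rw [Nat.card_eq_fintype_card] at hq
  exact ringChar.of_eq (FiniteField.even_card_iff_char_two.2 (Nat.even_iff.1 hq))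

theorem mainTheorem7 (F : Type*) [Field F] [Finite F] (hq : Even (Nat.card F)) (n : ℕ) :
    -- the number of involutions
    ((spInvolutions n F).ncard : ℚ) =
        (∑ r ∈ (Finset.Icc 0 n).filter Even, (spOrder F (2 * n) : ℚ) / (spA F n r : ℚ)) +
        (∑ r ∈ (Finset.Icc 1 n).filter Even, (spOrder F (2 * n) : ℚ) / (spB F n r : ℚ)) +
        (∑ r ∈ (Finset.Icc 1 n).filter Odd, (spOrder F (2 * n) : ℚ) / (spC F n r : ℚ)) ∧
    -- rank and attached symmetric form of an involution
    (∀ g ∈ spInvolutions n F, fixRank g ≤ n ∧ (attachedForm g).IsSymm ∧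
        (Odd (fixRank g) → ¬ (attachedForm g).IsAlt)) ∧
    -- the terms `|Sp(2n,q)| / A_r`: even rank, alternating form
    (∀ r ≤ n, Even r →
        ({g ∈ spInvolutions n F | fixRank g = r ∧ (attachedForm g).IsAlt}.ncard : ℚ) =
            (spOrder F (2 * n) : ℚ) / (spA F n r : ℚ) ∧
        ∀ g ∈ spInvolutions n F, fixRank g = r → (attachedForm g).IsAlt →
            Nat.card (Subgroup.centralizer {g}) = spA F n r) ∧
    -- the terms `|Sp(2n,q)| / B_r`: positive even rank, non-alternating form
    (∀ r ≤ n, 1 ≤ r → Even r →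
        ({g ∈ spInvolutions n F | fixRank g = r ∧ ¬ (attachedForm g).IsAlt}.ncard : ℚ) =
            (spOrder F (2 * n) : ℚ) / (spB F n r : ℚ) ∧
        ∀ g ∈ spInvolutions n F, fixRank g = r → ¬ (attachedForm g).IsAlt →
            Nat.card (Subgroup.centralizer {g}) = spB F n r) ∧
    -- the terms `|Sp(2n,q)| / C_r`: odd rank
    (∀ r ≤ n, Odd r →
        ({g ∈ spInvolutions n F | fixRank g = r}.ncard : ℚ) =
            (spOrder F (2 * n) : ℚ) / (spC F n r : ℚ) ∧
        ∀ g ∈ spInvolutions n F, fixRank g = r →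
            Nat.card (Subgroup.centralizer {g}) = spC F n r) := by
  have := charP_two_of_even_card F hq
  refine ⟨?_, fun g hg => ⟨fixRank_le hg, attachedForm_isSymm hg, not_isAlt_of_odd_fixRank hg⟩,
    fun r hr he => ?_, fun r hr h1 he => ?_, fun r hr ho => involutions_odd hr ho⟩
  · rw [ncard_spInvolutions_eq_sum]
    push_cast
    congr 1
    · congr 1
      · refine Finset.sum_congr rfl fun r hr => ?_
        rw [Finset.mem_filter, Finset.mem_Icc] at hr
        exact (involutions_alternating hr.1.2 hr.2).1
      · refine Finset.sum_congr rfl fun r hr => ?_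
        rw [Finset.mem_filter, Finset.mem_Icc] at hr
        exact (involutions_not_alternating hr.1.2 hr.1.1 hr.2).1
    · refine Finset.sum_congr rfl fun r hr => ?_
      rw [Finset.mem_filter, Finset.mem_Icc] at hr
      exact (involutions_odd hr.1.2 hr.2).1
  · exact (involutions_alternating hr he).imp_right fun h g hg h1 h2 => h g hg ⟨h1, h2⟩
  · exact (involutions_not_alternating hr h1 he).imp_right fun h g hg h1 h2 => h g hg ⟨h1, h2⟩
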